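/- Call a compact convex subset of a finite-dimensional real normed space with nonempty interior a \emph{convex body}; it is \emph{symmetric} if it is invariant under $x\mapsto -x$. Two subsets of real vector spaces are \emph{affinely equivalent} if an affine isomorphism between the ambient spaces maps one onto the other. An \emph{ellipsoid} is a set affinely equivalent to the closed unit ball of a Euclidean space. A convex body $K\subset\mathbb{R}^m$ is a \emph{body of revolution} if there is an affine line $L\subset\mathbb{R}^m$ such that, for every affine hyperplane $\Delta$ orthogonal to $L$, the section $K\cap\Delta$ is empty, a single point, or a Euclidean ball in $\Delta$, centered in the latter two cases at the point $\Delta\cap L$. An \emph{affine body of revolution} is a convex body affinely equivalent to a body of revolution. \textbf{Theorem.} Let $n\ge 4$ and let $B\subset\mathbb{R}^{n+1}$ be a symmetric convex body such that, for every $n$-dimensional linear subspace $H\subset\mathbb{R}^{n+1}$, the orthogonal projection of $B$ onto $H$ is a symmetric affine body of revolution (as a subset of $H$). Then there is an $n$-dimensional linear subspace $H\subset\mathbb{R}^{n+1}$ such that the orthogonal projection of $B$ onto $H$ is an ellipsoid in $H$. -/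

import Mathlib

namespace AffineRevolution

/-- A convex body: a compact convex set with nonempty interior. -/
structure IsConvexBody {V : Type*} [NormedAddCommGroup V] [NormedSpace ℝ V]
    (K : Set V) : Prop where
  convex : Convex ℝ K
  isCompact : IsCompact K
  interior_nonempty : (interior K).Nonempty

/-- A symmetric convex body: a convex body invariant under `x ↦ -x`. -/
structure IsSymmetricConvexBody {V : Type*} [NormedAddCommGroup V] [NormedSpace ℝ V]
    (K : Set V) : Prop extends IsConvexBody K where
  neg_mem : ∀ x ∈ K, -x ∈ K

/-- Two sets are affinely equivalent if some affine isomorphism between their ambient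
vector spaces maps one onto the other. -/
def AffinelyEquivalent {V W : Type*} [AddCommGroup V] [Module ℝ V]
    [AddCommGroup W] [Module ℝ W] (S : Set V) (T : Set W) : Prop :=
  ∃ f : V ≃ᵃ[ℝ] W, f '' S = T

/-- An ellipsoid: a set affinely equivalent to the closed unit ball of a Euclidean space
(whose dimension is then necessarily that of the ambient space). -/
def IsEllipsoid {V : Type*} [AddCommGroup V] [Module ℝ V] (S : Set V) : Prop :=
  ∃ m : ℕ, AffinelyEquivalent S (Metric.closedBall (0 : EuclideanSpace ℝ (Fin m)) 1)

/-- The affine line `L` is an axis of revolution of `K`: every section of `K` by an affine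
hyperplane `Δ` orthogonal to `L` is a Euclidean ball in `Δ` centered at the point `Δ ∩ L`.
The section may be a point (`r = 0`) or empty (`r < 0`). -/
def IsAxisOfRevolution {m : ℕ} (K : Set (EuclideanSpace ℝ (Fin m)))
    (L : AffineSubspace ℝ (EuclideanSpace ℝ (Fin m))) : Prop :=
  (L : Set (EuclideanSpace ℝ (Fin m))).Nonempty ∧ Module.finrank ℝ L.direction = 1 ∧
    ∀ Δ : AffineSubspace ℝ (EuclideanSpace ℝ (Fin m)),
      (Δ : Set (EuclideanSpace ℝ (Fin m))).Nonempty → Δ.direction = L.directionᗮ →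
        ∃ c ∈ L ⊓ Δ, ∃ r : ℝ,
          K ∩ (Δ : Set (EuclideanSpace ℝ (Fin m))) =
            Metric.closedBall c r ∩ (Δ : Set (EuclideanSpace ℝ (Fin m)))

/-- A body of revolution in `ℝᵐ`: a convex body that admits an axis of revolution. -/
def IsBodyOfRevolution {m : ℕ} (K : Set (EuclideanSpace ℝ (Fin m))) : Prop :=
  IsConvexBody K ∧ ∃ L : AffineSubspace ℝ (EuclideanSpace ℝ (Fin m)), IsAxisOfRevolution K L

/-- An affine body of revolution: a convex body affinely equivalent to a body of revolution. -/
def IsAffineBodyOfRevolution {V : Type*} [NormedAddCommGroup V] [NormedSpace ℝ V]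
    (S : Set V) : Prop :=
  IsConvexBody S ∧ ∃ (m : ℕ) (K : Set (EuclideanSpace ℝ (Fin m))),
    IsBodyOfRevolution K ∧ AffinelyEquivalent S K

/-- The orthogonal projection of `B` onto the linear subspace `H`, as a subset of `H`. -/
def proj {V : Type*} [NormedAddCommGroup V] [InnerProductSpace ℝ V] [FiniteDimensional ℝ V]
    (H : Submodule ℝ V) (B : Set V) : Set H :=
  (fun x : V => H.orthogonalProjectionOnto x) '' B

end AffineRevolution

/-! The support function `f` of `B` is a norm, and its restriction to `H` is the support function of
the projection onto `H`. Everything thus reduces to `exists_parallelogramOn_hyperplane`: in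
dimension at least 5, a norm whose restrictions to hyperplanes are all of revolution satisfies the
parallelogram law on some hyperplane.

Suppose it does not. On `ξᗮ`, `f` depends only on a Euclidean norm and on a coordinate `⟪a ξ, ·⟫`.
Call (ξ, η) a good pair if `f` is not Euclidean on W = ξᗮ ∩ ηᗮ. A non-Euclidean norm on a space of
dimension at least 3 is of revolution for at most one hyperplane of parallels
(`parallelogram_of_two_revolutions`). For a good pair, comparing the two structures on W gives `a η`
∈ span {ξ, η, a ξ}, so the planes P(ξ) = span {ξ, a ξ} and P(η) lie in a common 3-space and share a
line. Good pairs form an open set near independent pairs, and (ξ, η) is good whenever η is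
orthogonal to the axis `e ξ`.

A vector m common to P(ξ₁) and P(ξ₂) lies in P(ζ) for every ζ in general position forming good pairs
with both. Hence {ζ | m ∈ P(ζ)} has interior, and a touching-ball argument spreads this interior
over the complement of the line ℝm. Given x, y orthogonal to m, take ξ off that line and orthogonal
to both; since m ∈ P(ξ), also `a ξ` is orthogonal to x and y, and `f` is Euclidean on ξᗮ ∩ (a ξ)ᗮ.
So the parallelogram law holds on mᗮ, a contradiction. -/

namespace AffineRevolution

open scoped RealInnerProductSpace
open Module

/-! ### Functions on a sphere invariant about two axes -/

section Sphere

variable {F : Type*} [NormedAddCommGroup F] [InnerProductSpace ℝ F]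

theorem norm_sq_orthonormal_combination {e w v : F} (he : ⟪e, e⟫ = 1) (hw : ⟪w, w⟫ = 1)
    (hv : ⟪v, v⟫ = 1) (hew : ⟪e, w⟫ = 0) (hev : ⟪e, v⟫ = 0) (hwv : ⟪w, v⟫ = 0) (s a b : ℝ) :
    ‖s • e + a • w + b • v‖ ^ 2 = s ^ 2 + a ^ 2 + b ^ 2 := by
  have hwe : ⟪w, e⟫ = 0 := by rw [real_inner_comm]; exact hew
  have hve : ⟪v, e⟫ = 0 := by rw [real_inner_comm]; exact hev
  have hvw : ⟪v, w⟫ = 0 := by rw [real_inner_comm]; exact hwv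
  rw [← real_inner_self_eq_norm_sq]
  simp only [inner_add_left, inner_add_right, real_inner_smul_left, real_inner_smul_right,
    he, hw, hv, hew, hev, hwv, hwe, hve, hvw]
  ring

/-- A function on the sphere that is constant along the parallels of two distinct axes is
constant. -/
theorem constant_on_sphere_of_frame (g : F → ℝ) {e w v : F} (he : ⟪e, e⟫ = 1)
    (hw : ⟪w, w⟫ = 1) (hv : ⟪v, v⟫ = 1) (hew : ⟪e, w⟫ = 0) (hev : ⟪e, v⟫ = 0)
    (hwv : ⟪w, v⟫ = 0) (c k : ℝ) (hk : k ≠ 0)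
    (h₁ : ∀ x y : F, ‖x‖ = ‖y‖ → ⟪e, x⟫ = ⟪e, y⟫ → g x = g y)
    (h₂ : ∀ x y : F, ‖x‖ = ‖y‖ → ⟪c • e + k • w, x⟫ = ⟪c • e + k • w, y⟫ → g x = g y)
    {x : F} (hx : ‖x‖ = 1) : g x = g v := by
  have hwe : ⟪w, e⟫ = 0 := by rw [real_inner_comm]; exact hew
  set φ : ℝ → ℝ := fun s => g (s • e + (0 : ℝ) • w + √(1 - s ^ 2) • v) with hφ
  have hn := norm_sq_orthonormal_combination he hw hv hew hev hwv
  have hie : ∀ s a b : ℝ, ⟪e, s • e + a • w + b • v⟫ = s := by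
    intro s a b
    simp only [inner_add_right, real_inner_smul_right, he, hew, hev]
    ring
  have hiw : ∀ s a b : ℝ, ⟪w, s • e + a • w + b • v⟫ = a := by
    intro s a b
    simp only [inner_add_right, real_inner_smul_right, hw, hwe, hwv]
    ring
  have hnorm : ∀ {x y : F}, ‖x‖ ^ 2 = ‖y‖ ^ 2 → ‖x‖ = ‖y‖ := fun h =>
    (sq_eq_sq₀ (norm_nonneg _) (norm_nonneg _)).1 h
  have hgφ : ∀ y : F, ‖y‖ = 1 → g y = φ ⟪e, y⟫ := by
    intro y hy
    apply h₁
    · apply hnorm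
      have h1 : ⟪e, y⟫ ^ 2 ≤ 1 := by
        have := abs_real_inner_le_norm e y
        have h2 : ‖e‖ = 1 := by
          have : ‖e‖ ^ 2 = 1 := by rw [← real_inner_self_eq_norm_sq, he]
          nlinarith [norm_nonneg e]
        rw [h2, hy] at this
        rw [← sq_abs]; nlinarith [abs_nonneg ⟪e, y⟫]
      rw [hn, Real.sq_sqrt (by linarith), hy]; ring
    · rw [hie]
  -- A parallel of the second axis through a point of height `s` over `e` also contains points of
  -- other heights `t`: `a` is the `w`-coordinate that keeps the product with `c • e + k • w` fixed,
  -- and `b` puts the point on the sphere. The profile `φ` is therefore locally constant inside the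
  -- interval.
  have key : ∀ s t : ℝ, s ^ 2 ≤ 1 → 0 ≤ 1 - t ^ 2 - (c * (s - t) / k) ^ 2 → φ s = φ t := by
    intro s t hs ht
    set a := c * (s - t) / k with ha
    set b := √(1 - t ^ 2 - a ^ 2)
    have hy1 : ‖t • e + a • w + b • v‖ = 1 := by
      have : ‖t • e + a • w + b • v‖ ^ 2 = 1 := by
        rw [hn, Real.sq_sqrt ht]; ring
      nlinarith [norm_nonneg (t • e + a • w + b • v)]
    have h1 : φ s = g (t • e + a • w + b • v) := by
      apply h₂
      · apply hnorm
        rw [hn, hy1, Real.sq_sqrt (by linarith)]; ring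
      · rw [inner_add_left, inner_add_left, real_inner_smul_left, real_inner_smul_left,
          real_inner_smul_left, real_inner_smul_left, hie, hiw, hie, hiw, ha]
        field_simp
        ring
    rw [h1, hgφ _ hy1, hie]
  have hconst : ∀ s ∈ Set.Ioo (-1 : ℝ) 1, φ s = φ 0 := by
    have hd : ∀ s ∈ Set.Ioo (-1 : ℝ) 1, HasDerivAt φ 0 s := by
      intro s hs
      have hcont : Continuous fun t : ℝ => 1 - t ^ 2 - (c * (s - t) / k) ^ 2 := by fun_prop
      have hpos : 0 < 1 - s ^ 2 - (c * (s - s) / k) ^ 2 := by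
        have := hs.1; have := hs.2
        simp only [sub_self, mul_zero, zero_div]; nlinarith
      have hev : ∀ᶠ t in nhds s, φ t = φ s := by
        filter_upwards [hcont.continuousAt.eventually (lt_mem_nhds hpos)] with t ht
        exact (key s t (by nlinarith [hs.1, hs.2]) ht.le).symm
      exact (hasDerivAt_const s (φ s)).congr_of_eventuallyEq hev
    intro s hs
    exact isOpen_Ioo.is_const_of_deriv_eq_zero isPreconnected_Ioo
      (fun s hs => (hd s hs).differentiableAt.differentiableWithinAt)
      (fun s hs => (hd s hs).deriv) hs (by norm_num)
  have hall : ∀ s : ℝ, s ^ 2 ≤ 1 → φ s = φ 0 := by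
    intro s hs
    rcases hs.lt_or_eq with h | h
    · exact hconst s (by constructor <;> nlinarith)
    -- At a pole, `key` is applied with `t = s * (1 - δ)`; this `δ` makes the radicand equal to `δ`,
    -- hence nonnegative, and `t` is interior.
    · set δ := 1 / (1 + (c / k) ^ 2) with hδ
      have hq : 0 ≤ (c / k) ^ 2 := sq_nonneg _
      have hδ0 : 0 < δ := by positivity
      have hδ1 : δ ≤ 1 := by
        rw [hδ, div_le_one (by positivity)]; linarith
      have hδe : δ * (1 + (c / k) ^ 2) = 1 := by
        rw [hδ]; field_simp
      have e1 : c * (s - s * (1 - δ)) / k = (c / k) * s * δ := by ring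
      rw [key s (s * (1 - δ)) hs ?_]
      · apply hconst
        have : (s * (1 - δ)) ^ 2 < 1 := by
          rw [mul_pow, h]; nlinarith
        constructor <;> nlinarith
      · rw [e1]
        have : 1 - (s * (1 - δ)) ^ 2 - (c / k * s * δ) ^ 2
            = 1 - s ^ 2 + s ^ 2 * (2 * δ - δ * (δ * (1 + (c / k) ^ 2))) := by ring
        rw [this, hδe, h]; linarith
  have hv1 : ‖v‖ = 1 := by
    have : ‖v‖ ^ 2 = 1 := by rw [← real_inner_self_eq_norm_sq, hv]
    nlinarith [norm_nonneg v]
  rw [hgφ x hx, hgφ v hv1, hev, hall]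
  have := abs_real_inner_le_norm e x
  have h2 : ‖e‖ = 1 := by
    have : ‖e‖ ^ 2 = 1 := by rw [← real_inner_self_eq_norm_sq, he]
    nlinarith [norm_nonneg e]
  rw [h2, hx] at this
  rw [← sq_abs]; nlinarith [abs_nonneg ⟪e, x⟫]

theorem exists_unit_inner_eq_zero [FiniteDimensional ℝ F] (s : Finset F)
    (hs : s.card < finrank ℝ F) : ∃ v : F, ‖v‖ = 1 ∧ ∀ x ∈ s, ⟪x, v⟫ = 0 := by
  have h1 : finrank ℝ (Submodule.span ℝ (s : Set F)) < finrank ℝ F :=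
    (finrank_span_finset_le_card s).trans_lt hs
  have h2 := Submodule.finrank_add_finrank_orthogonal (Submodule.span ℝ (s : Set F))
  have h3 : 0 < finrank ℝ (Submodule.span ℝ (s : Set F))ᗮ := by omega
  obtain ⟨⟨v, hv⟩, hv0⟩ := (Module.finrank_pos_iff_exists_ne_zero).1 h3
  have hv0' : v ≠ 0 := fun h => hv0 (Subtype.ext h)
  refine ⟨(‖v‖)⁻¹ • v, by simp [norm_smul, hv0'], fun x hx => ?_⟩
  rw [real_inner_smul_right, (Submodule.mem_orthogonal _ _).1 hv x (Submodule.subset_span hx),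
    mul_zero]

/-- The vector `z` certifies that `u'` is not a multiple of `u`, so Gram–Schmidt gives `e`, `w`;
dimension 3 leaves room for the third vector `v`. -/
theorem constant_on_sphere [FiniteDimensional ℝ F] (hdim : 3 ≤ finrank ℝ F) (g : F → ℝ)
    {u u' z : F} (hu : u ≠ 0) (hz : ⟪u, z⟫ = 0) (hz' : ⟪u', z⟫ ≠ 0)
    (h₁ : ∀ x y : F, ‖x‖ = ‖y‖ → ⟪u, x⟫ = ⟪u, y⟫ → g x = g y)
    (h₂ : ∀ x y : F, ‖x‖ = ‖y‖ → ⟪u', x⟫ = ⟪u', y⟫ → g x = g y) :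
    ∃ C, ∀ x : F, ‖x‖ = 1 → g x = C := by
  classical
  have hun : ‖u‖ ≠ 0 := norm_ne_zero_iff.2 hu
  set e := (‖u‖)⁻¹ • u with he
  have hee : ⟪e, e⟫ = 1 := by
    rw [he, real_inner_smul_left, real_inner_smul_right, real_inner_self_eq_norm_sq]
    field_simp
  set c := ⟪e, u'⟫ with hc
  set w' := u' - c • e with hw'
  have hew' : ⟪e, w'⟫ = 0 := by
    rw [hw', inner_sub_right, real_inner_smul_right, hee, hc]; ring
  have hw'0 : w' ≠ 0 := by
    intro h
    apply hz'
    have : u' = c • e := sub_eq_zero.1 h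
    rw [this, real_inner_smul_left, he, real_inner_smul_left, hz]; ring
  have hk : ‖w'‖ ≠ 0 := norm_ne_zero_iff.2 hw'0
  set w := (‖w'‖)⁻¹ • w' with hw
  have hww : ⟪w, w⟫ = 1 := by
    rw [hw, real_inner_smul_left, real_inner_smul_right, real_inner_self_eq_norm_sq]
    field_simp
  have hew : ⟪e, w⟫ = 0 := by rw [hw, real_inner_smul_right, hew', mul_zero]
  obtain ⟨v, hv1, hv⟩ := exists_unit_inner_eq_zero ({e, w} : Finset F)
    ((Finset.card_le_two).trans_lt hdim)
  have hdec : u' = c • e + ‖w'‖ • w := by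
    rw [hw, smul_inv_smul₀ hk, hw']; abel
  refine ⟨g v, fun x hx => constant_on_sphere_of_frame g hee hww ?_ hew (hv e (by simp))
    (hv w (by simp)) c ‖w'‖ hk ?_ ?_ hx⟩
  · rw [real_inner_self_eq_norm_sq, hv1]; norm_num
  · intro x y hxy h
    apply h₁ x y hxy
    rw [he, real_inner_smul_left, real_inner_smul_left] at h
    exact mul_left_cancel₀ (inv_ne_zero hun) h
  · rw [← hdec]; exact h₂

end Sphere

/-! ### Norms and the parallelogram law -/

section Norms

/-- A norm on a finite-dimensional real space, given as a function. -/
structure IsNormFunction {E : Type*} [NormedAddCommGroup E] [NormedSpace ℝ E] (f : E → ℝ) :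
    Prop where
  continuous : Continuous f
  map_smul : ∀ (c : ℝ) (x : E), f (c • x) = |c| * f x
  pos : ∀ x : E, x ≠ 0 → 0 < f x
  add_le : ∀ x y : E, f (x + y) ≤ f x + f y

theorem IsNormFunction.map_zero {E : Type*} [NormedAddCommGroup E] [NormedSpace ℝ E]
    {f : E → ℝ} (hf : IsNormFunction f) : f 0 = 0 := by
  simpa using hf.map_smul 0 0

/-- The parallelogram law on a subspace. -/
def ParallelogramOn {E : Type*} [AddCommGroup E] [Module ℝ E] (f : E → ℝ)
    (W : Submodule ℝ E) : Prop :=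
  ∀ x ∈ W, ∀ y ∈ W, f (x + y) ^ 2 + f (x - y) ^ 2 = 2 * f x ^ 2 + 2 * f y ^ 2

theorem exists_linearEquiv_of_bilinear {E : Type*} [AddCommGroup E] [Module ℝ E]
    [FiniteDimensional ℝ E] (b : E → E → ℝ) (hsymm : ∀ x y, b x y = b y x)
    (hadd : ∀ x y z, b (x + y) z = b x z + b y z) (hsmul : ∀ (c : ℝ) x y, b (c • x) y = c * b x y)
    (hpos : ∀ x, x ≠ 0 → 0 < b x x) :
    ∃ T : E ≃ₗ[ℝ] EuclideanSpace ℝ (Fin (finrank ℝ E)), ∀ x, ‖T x‖ ^ 2 = b x x := by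
  have h0 : ∀ y, b 0 y = 0 := fun y => by simpa using hsmul 0 0 y
  let c : InnerProductSpace.Core ℝ E :=
    { inner := b
      conj_inner_symm := fun x y => by simpa using hsymm y x
      re_inner_nonneg := fun x => by
        by_cases hx : x = 0
        · simp [hx, h0]
        · simpa using (hpos x hx).le
      add_left := hadd
      smul_left := fun x y r => by simpa using hsmul r x y
      definite := fun x hx => by
        by_contra h
        exact (hpos x h).ne' hx }
  let _ : NormedAddCommGroup E := c.toNormedAddCommGroup
  let _ : InnerProductSpace ℝ E := InnerProductSpace.ofCore c.toCore
  refine ⟨(stdOrthonormalBasis ℝ E).repr.toLinearEquiv, fun x => ?_⟩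
  have : ‖(stdOrthonormalBasis ℝ E).repr.toLinearEquiv x‖ = ‖x‖ :=
    (stdOrthonormalBasis ℝ E).repr.norm_map x
  rw [this, ← real_inner_self_eq_norm_sq]
  rfl

theorem exists_linearEquiv_of_parallelogram {E : Type*} [AddCommGroup E] [Module ℝ E]
    [FiniteDimensional ℝ E] (f : E → ℝ) (hsmul : ∀ (c : ℝ) x, f (c • x) = |c| * f x)
    (hpos : ∀ x, x ≠ 0 → 0 < f x) (hadd : ∀ x y, f (x + y) ≤ f x + f y)
    (hpar : ∀ x y, f (x + y) ^ 2 + f (x - y) ^ 2 = 2 * f x ^ 2 + 2 * f y ^ 2) :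
    ∃ T : E ≃ₗ[ℝ] EuclideanSpace ℝ (Fin (finrank ℝ E)), ∀ x, ‖T x‖ = f x := by
  have h0 : f 0 = 0 := by simpa using hsmul 0 0
  let N : AddGroupNorm E :=
    { toFun := f
      map_zero' := h0
      add_le' := hadd
      neg' := fun x => by simpa using hsmul (-1) x
      eq_zero_of_map_eq_zero' := fun x hx => by
        by_contra h
        exact (hpos x h).ne' hx }
  let _ : NormedAddCommGroup E := N.toNormedAddCommGroup
  have hn : ∀ x : E, ‖x‖ = f x := fun x => rfl
  let _ : NormedSpace ℝ E := ⟨fun c x => by rw [hn, hn, hsmul, Real.norm_eq_abs]⟩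
  let _ : InnerProductSpace ℝ E := InnerProductSpace.ofNorm ℝ fun x y => by
    simp only [hn]
    nlinarith [hpar x y]
  refine ⟨(stdOrthonormalBasis ℝ E).repr.toLinearEquiv, fun x => ?_⟩
  exact (stdOrthonormalBasis ℝ E).repr.norm_map x

/-- The contragredient of a linear isomorphism to a Euclidean space. -/
theorem exists_contragredient {X : Type*} [NormedAddCommGroup X]
    [InnerProductSpace ℝ X] [FiniteDimensional ℝ X] {m : ℕ} (T : X ≃ₗ[ℝ] EuclideanSpace ℝ (Fin m)) :
    ∃ A : X ≃ₗ[ℝ] EuclideanSpace ℝ (Fin m), ∀ x y, ⟪A x, T y⟫ = ⟪x, y⟫ := by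
  set A := (LinearMap.adjoint (T.symm : EuclideanSpace ℝ (Fin m) →ₗ[ℝ] X)) with hA
  have hAT : ∀ x y, ⟪A x, T y⟫ = ⟪x, y⟫ := by
    intro x y
    rw [hA, LinearMap.adjoint_inner_left]
    simp
  have hinj : Function.Injective A := by
    rw [injective_iff_map_eq_zero]
    intro x hx
    have := hAT x x
    rw [hx, inner_zero_left] at this
    exact inner_self_eq_zero.1 this.symm
  exact ⟨LinearEquiv.ofInjectiveOfFinrankEq A hinj T.finrank_eq, hAT⟩

/-- By homogeneity, a norm that depends only on `‖A x‖` is a constant multiple of it. -/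
theorem parallelogramOn_of_norm_map {E F : Type*} [NormedAddCommGroup E] [NormedSpace ℝ E]
    [NormedAddCommGroup F] [InnerProductSpace ℝ F] {f : E → ℝ} (hf : IsNormFunction f)
    {W : Submodule ℝ E} (A : E →ₗ[ℝ] F) (hA : ∀ x ∈ W, A x = 0 → x = 0)
    (h : ∀ x ∈ W, ∀ y ∈ W, ‖A x‖ = ‖A y‖ → f x = f y) : ParallelogramOn f W := by
  have : ∃ C, ∀ x ∈ W, f x = C * ‖A x‖ := by
    by_cases hW : ∃ x₀ ∈ W, x₀ ≠ 0
    · obtain ⟨x₀, hx₀, hne⟩ := hW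
      have hA0 : ‖A x₀‖ ≠ 0 := norm_ne_zero_iff.2 fun h => hne (hA x₀ hx₀ h)
      refine ⟨f x₀ / ‖A x₀‖, fun x hx => ?_⟩
      have h1 : f x = f ((‖A x‖ / ‖A x₀‖) • x₀) := by
        apply h x hx _ (W.smul_mem _ hx₀)
        rw [map_smul, norm_smul, Real.norm_of_nonneg (by positivity)]
        field_simp
      rw [h1, hf.map_smul, abs_of_nonneg (by positivity)]
      ring
    · push Not at hW
      refine ⟨0, fun x hx => ?_⟩
      rw [hW x hx]
      simpa using hf.map_smul 0 0
  obtain ⟨C, hC⟩ := this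
  intro x hx y hy
  rw [hC _ (W.add_mem hx hy), hC _ (W.sub_mem hx hy), hC x hx, hC y hy, map_add, map_sub]
  have := parallelogram_law_with_norm ℝ (A x) (A y)
  linear_combination C ^ 2 * this

end Norms

/-! ### An invariant Euclidean structure from the inertia form -/

section BinetLegendre

open MeasureTheory

variable {E : Type*} [NormedAddCommGroup E] [InnerProductSpace ℝ E] [FiniteDimensional ℝ E]

theorem IsNormFunction.exists_norm_le {f : E → ℝ} (hf : IsNormFunction f) :
    ∃ C, ∀ x, f x ≤ 1 → ‖x‖ ≤ C := by
  by_cases hE : ∃ x₀ : E, x₀ ≠ 0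
  · obtain ⟨x₀, hx₀⟩ := hE
    have hne : (Metric.sphere (0 : E) 1).Nonempty :=
      ⟨(‖x₀‖)⁻¹ • x₀, by simp [norm_smul, hx₀]⟩
    obtain ⟨m, hm, hmin⟩ := (isCompact_sphere (0 : E) 1).exists_isMinOn hne
      hf.continuous.continuousOn
    have hm0 : m ≠ 0 := by
      rintro rfl
      simp at hm
    have hmp := hf.pos m hm0
    refine ⟨1 / f m, fun x hx => ?_⟩
    by_cases hx0 : x = 0
    · rw [hx0, norm_zero]; positivity
    have h1 : f m ≤ f ((‖x‖)⁻¹ • x) := hmin (by simp [norm_smul, hx0])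
    have hxp : 0 < ‖x‖ := norm_pos_iff.2 hx0
    rw [hf.map_smul, abs_of_nonneg (by positivity)] at h1
    rw [le_div_iff₀ hmp]
    calc ‖x‖ * f m ≤ ‖x‖ * (‖x‖⁻¹ * f x) := by gcongr
      _ = f x := by field_simp
      _ ≤ 1 := hx
  · push Not at hE
    exact ⟨0, fun x _ => by simp [hE x]⟩

/-- A Euclidean structure invariant under all linear involutions that preserve a given norm. -/
theorem exists_invariant_euclidean {f : E → ℝ} (hf : IsNormFunction f) :
    ∃ T : E ≃ₗ[ℝ] EuclideanSpace ℝ (Fin (finrank ℝ E)), ∀ g : E →ₗ[ℝ] E,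
      (∀ x, g (g x) = x) → (∀ x, f (g x) = f x) → ∀ x, ‖T (g x)‖ = ‖T x‖ := by
  borelize E
  -- A continuous, compactly supported weight that sees `z` only through `f z`; its second-moment
  -- form `b` inherits the symmetries of `f`. As `b` lives on the dual side, `T` is taken
  -- contragredient to it.
  set w : E → ℝ := fun z => max 0 (1 - f z) with hw
  have hwc : Continuous w := continuous_const.max (continuous_const.sub hf.continuous)
  have hwn : ∀ z, 0 ≤ w z := fun z => le_max_left _ _
  have hws : HasCompactSupport w := by
    obtain ⟨C, hC⟩ := hf.exists_norm_le
    refine HasCompactSupport.intro (isCompact_closedBall (0 : E) C) fun x hx => ?_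
    rw [mem_closedBall_zero_iff] at hx
    have : ¬ f x ≤ 1 := fun h => hx (hC x h)
    exact max_eq_left (by linarith)
  have hint : ∀ x y : E, Integrable fun z => w z * (⟪x, z⟫ * ⟪y, z⟫) := fun x y =>
    Continuous.integrable_of_hasCompactSupport (by fun_prop) hws.mul_right
  set b : E → E → ℝ := fun x y => ∫ z, w z * (⟪x, z⟫ * ⟪y, z⟫) with hb
  obtain ⟨S, hS⟩ := exists_linearEquiv_of_bilinear b
    (fun x y => by simp only [hb]; congr 1; ext z; ring)
    (fun x y z => by
      simp only [hb]
      rw [← integral_add (hint _ _) (hint _ _)]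
      congr 1; ext t; rw [inner_add_left]; ring)
    (fun c x y => by
      simp only [hb]
      rw [← integral_const_mul]
      congr 1; ext t; rw [real_inner_smul_left]; ring)
    (fun x hx => by
      refine Continuous.integral_pos_of_hasCompactSupport_nonneg_nonzero
        (x := (1 / (2 * f x)) • x) (by fun_prop) hws.mul_right (fun z => ?_) ?_
      · exact mul_nonneg (hwn z) (mul_self_nonneg _)
      · have hfx := hf.pos x hx
        have h1 : w ((1 / (2 * f x)) • x) = 1 / 2 := by
          simp only [hw]
          rw [hf.map_smul, abs_of_nonneg (by positivity)]
          have : 1 / (2 * f x) * f x = 1 / 2 := by field_simp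
          rw [this]; norm_num
        have hxx : ⟪x, x⟫ ≠ 0 := inner_self_ne_zero.2 hx
        rw [h1, real_inner_smul_right]
        positivity)
  obtain ⟨T, hTS⟩ := exists_contragredient S
  -- An involution has determinant ±1, so it preserves volume and its adjoint preserves `b`.
  -- Cauchy–Schwarz against the vector dual to `T x` turns this into an inequality for `T`; applying
  -- it to `g x` as well gives equality.
  have hle : ∀ g : E →ₗ[ℝ] E, (∀ x, g (g x) = x) → (∀ x, f (g x) = f x) →
      ∀ x, ‖T x‖ ≤ ‖T (g x)‖ := by
    intro g hg hfg x
    have hgg : g * g = 1 := LinearMap.ext hg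
    have hdet : LinearMap.det g * LinearMap.det g = 1 := by
      rw [← map_mul, hgg, map_one]
    have hdet0 : LinearMap.det g ≠ 0 := fun h => by simp [h] at hdet
    have habs : |(LinearMap.det g)⁻¹| = 1 := by
      rcases mul_self_eq_one_iff.1 hdet with h | h <;> simp [h]
    have hgc : Continuous g := g.continuous_of_finiteDimensional
    have hmp : MeasurePreserving g (volume : Measure E) volume := by
      refine ⟨hgc.measurable, ?_⟩
      rw [Measure.map_linearMap_addHaar_eq_smul_addHaar _ hdet0, habs]
      simp
    have hemb : MeasurableEmbedding g :=
      (Homeomorph.mk (⟨g, g, hg, hg⟩ : E ≃ E) hgc hgc).measurableEmbedding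
    have hSg : ∀ y, ‖S (LinearMap.adjoint g y)‖ = ‖S y‖ := by
      intro y
      rw [← sq_eq_sq₀ (norm_nonneg _) (norm_nonneg _), hS, hS]
      simp only [hb, LinearMap.adjoint_inner_left]
      rw [← hmp.integral_comp hemb fun z => w z * (⟪y, z⟫ * ⟪y, z⟫)]
      simp only [hw, hfg]
    obtain ⟨y, hy⟩ := S.surjective (T x)
    have h1 : ⟪T (g x), S (LinearMap.adjoint g y)⟫ = ‖T x‖ * ‖T x‖ := by
      rw [hTS, LinearMap.adjoint_inner_right, hg, ← hTS, hy, real_inner_self_eq_norm_mul_norm]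
    have h2 := real_inner_le_norm (T (g x)) (S (LinearMap.adjoint g y))
    rw [h1, hSg, hy] at h2
    rcases (norm_nonneg (T x)).eq_or_lt with h | h
    · rw [← h]; exact norm_nonneg _
    · exact le_of_mul_le_mul_right h2 h
  refine ⟨T, fun g hg hfg x => ?_⟩
  refine le_antisymm ?_ (hle g hg hfg x)
  have := hle g hg hfg (g x)
  rw [hg] at this
  exact this

end BinetLegendre

/-! ### Uniqueness of the structure of revolution -/

section Uniqueness

variable {E : Type*} [NormedAddCommGroup E] [InnerProductSpace ℝ E]

/-- The `A`-orthogonal reflection along `v = x - y` preserves `‖A ·‖` and `l`, hence `f`, hence `‖T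
·‖`. It is then also the `T`-orthogonal reflection along `v`, which exchanges `x` and `y`. All
structures of revolution of `f` can thus be read in the single Euclidean structure `T`. -/
theorem revolution_of_invariant {F G : Type*} [NormedAddCommGroup F] [InnerProductSpace ℝ F]
    [NormedAddCommGroup G] [InnerProductSpace ℝ G] {f : E → ℝ} {T : E →ₗ[ℝ] G}
    (hTinj : Function.Injective T)
    (hT : ∀ g : E →ₗ[ℝ] E, (∀ x, g (g x) = x) → (∀ x, f (g x) = f x) → ∀ x, ‖T (g x)‖ = ‖T x‖)
    {A : E →ₗ[ℝ] F} (hA : Function.Injective A) (l : E →ₗ[ℝ] ℝ)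
    (h : ∀ x y, ‖A x‖ = ‖A y‖ → l x = l y → f x = f y) (x y : E) (hxy : ‖T x‖ = ‖T y‖)
    (hl : l x = l y) : f x = f y := by
  by_cases hne : x = y
  · rw [hne]
  set v := x - y with hv
  have hv0 : v ≠ 0 := sub_ne_zero.2 hne
  have hlv : l v = 0 := by rw [hv, map_sub, hl, sub_self]
  have hAv : ‖A v‖ ^ 2 ≠ 0 :=
    pow_ne_zero 2 (norm_ne_zero_iff.2 fun h => hv0 (hA (h.trans (map_zero A).symm)))
  have hTv : ‖T v‖ ^ 2 ≠ 0 :=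
    pow_ne_zero 2 (norm_ne_zero_iff.2 fun h => hv0 (hTinj (h.trans (map_zero T).symm)))
  set t : E →ₗ[ℝ] ℝ := (2 / ‖A v‖ ^ 2) • ((innerₛₗ ℝ (A v)).comp A) with ht
  have htz : ∀ z, t z = 2 / ‖A v‖ ^ 2 * ⟪A v, A z⟫ := fun z => by simp [ht]
  have htv : t v = 2 := by
    rw [htz, real_inner_self_eq_norm_sq, div_mul_cancel₀ _ hAv]
  set ρ : E →ₗ[ℝ] E := LinearMap.id - t.smulRight v with hρ
  have hρz : ∀ z, ρ z = z - t z • v := fun z => by simp [hρ]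
  have hinv : ∀ z, ρ (ρ z) = z := by
    intro z
    rw [hρz, hρz, map_sub, map_smul, htv, smul_eq_mul, sub_sub, ← add_smul]
    have : t z + (t z - t z * 2) = 0 := by ring
    rw [this, zero_smul, sub_zero]
  have hfρ : ∀ z, f (ρ z) = f z := by
    intro z
    apply h
    · rw [← sq_eq_sq₀ (norm_nonneg _) (norm_nonneg _), hρz, map_sub, map_smul, norm_sub_sq_real,
        real_inner_smul_right, norm_smul, mul_pow, Real.norm_eq_abs, sq_abs, real_inner_comm,
        htz]
      field_simp
      ring
    · rw [hρz, map_sub, map_smul, hlv, smul_zero, sub_zero]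
  have hTρ := hT ρ hinv hfρ
  have hexp : ∀ z, t z * (t z * ‖T v‖ ^ 2 - 2 * ⟪T z, T v⟫) = 0 := by
    intro z
    have h1 : ‖T (ρ z)‖ ^ 2 = ‖T z‖ ^ 2 := by rw [hTρ z]
    rw [hρz, map_sub, map_smul, norm_sub_sq_real, real_inner_smul_right, norm_smul, mul_pow,
      Real.norm_eq_abs, sq_abs] at h1
    linarith
  have hxv : 2 * ⟪T x, T v⟫ = ‖T v‖ ^ 2 := by
    have h1 : T y = T x - T v := by rw [hv, map_sub]; abel
    have h2 : ‖T x‖ ^ 2 = ‖T y‖ ^ 2 := by rw [hxy]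
    rw [h1, norm_sub_sq_real] at h2
    linarith
  -- `hexp` leaves only `t x = 0` or `t x = 1`; the first is excluded by `hexp` at `x + v`, where
  -- `t` equals 2.
  have htx : t x = 1 := by
    rcases mul_eq_zero.1 (hexp x) with h0 | h1
    · exfalso
      have h1 := hexp (x + v)
      rw [map_add, map_add, htv, h0, inner_add_left, real_inner_self_eq_norm_sq] at h1
      apply hTv
      linarith
    · rw [hxv] at h1
      have : (t x - 1) * ‖T v‖ ^ 2 = 0 := by linarith
      rcases mul_eq_zero.1 this with h | h
      · linarith
      · exact absurd h hTv
  have : ρ x = y := by rw [hρz, htx, one_smul, hv]; abel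
  rw [← hfρ x, this]

/-- If a norm is a norm of revolution with respect to two different hyperplanes, then it is
Euclidean. -/
theorem parallelogram_of_two_revolutions [FiniteDimensional ℝ E] {F F' : Type*}
    [NormedAddCommGroup F]
    [InnerProductSpace ℝ F] [NormedAddCommGroup F'] [InnerProductSpace ℝ F']
    (hdim : 3 ≤ finrank ℝ E) {f : E → ℝ} (hf : IsNormFunction f)
    {A : E →ₗ[ℝ] F} (hA : Function.Injective A) (l : E →ₗ[ℝ] ℝ)
    (h : ∀ x y, ‖A x‖ = ‖A y‖ → l x = l y → f x = f y)
    {A' : E →ₗ[ℝ] F'} (hA' : Function.Injective A') (l' : E →ₗ[ℝ] ℝ)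
    (h' : ∀ x y, ‖A' x‖ = ‖A' y‖ → l' x = l' y → f x = f y)
    {z : E} (hz : l z = 0) (hz' : l' z ≠ 0) : ParallelogramOn f ⊤ := by
  by_cases hl : l = 0
  · refine parallelogramOn_of_norm_map hf A (fun x _ hx => hA (hx.trans (map_zero A).symm))
      fun x _ y _ hxy => h x y hxy (by simp [hl])
  obtain ⟨T, hT⟩ := exists_invariant_euclidean hf
  have h1 := revolution_of_invariant (T := T.toLinearMap) T.injective hT hA l h
  have h2 := revolution_of_invariant (T := T.toLinearMap) T.injective hT hA' l' h'
  have riesz : ∀ k : E →ₗ[ℝ] ℝ, ∃ u : EuclideanSpace ℝ (Fin (finrank ℝ E)),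
      ∀ x, ⟪u, x⟫ = k (T.symm x) := by
    intro k
    refine ⟨LinearMap.adjoint (k.comp (T.symm : _ →ₗ[ℝ] E)) 1, fun x => ?_⟩
    rw [LinearMap.adjoint_inner_left]
    simp
  obtain ⟨u, hu⟩ := riesz l
  obtain ⟨u', hu'⟩ := riesz l'
  have hu0 : u ≠ 0 := by
    rintro rfl
    apply hl
    ext x
    have := hu (T x)
    simpa using this.symm
  obtain ⟨C, hC⟩ := constant_on_sphere (u := u) (u' := u') (z := T z) (by simpa using hdim)
    (fun x => f (T.symm x)) hu0 (by rw [hu]; simpa using hz) (by rw [hu']; simpa using hz')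
    (fun x y hxy huxy => h1 _ _ (by simpa using hxy) (by rw [← hu, ← hu, huxy]))
    (fun x y hxy huxy => h2 _ _ (by simpa using hxy) (by rw [← hu', ← hu', huxy]))
  have hval : ∀ x, f x = C * ‖T x‖ := by
    intro x
    by_cases hx : x = 0
    · simp [hx, hf.map_zero]
    have hTx : ‖T x‖ ≠ 0 := by simpa using hx
    have h3 := hC ((‖T x‖)⁻¹ • T x) (by simp [norm_smul, hx])
    simp only [map_smul, LinearEquiv.symm_apply_apply] at h3
    rw [hf.map_smul, abs_of_nonneg (by positivity)] at h3
    rw [← h3]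
    field_simp
  refine parallelogramOn_of_norm_map hf T.toLinearMap (fun x _ hx => by simpa using hx)
    fun x _ y _ hxy => ?_
  have hxy' : ‖T x‖ = ‖T y‖ := hxy
  rw [hval, hval, hxy']

end Uniqueness

/-! ### Restrictions of revolution in an ambient space -/

section Axis

variable {V : Type*} [NormedAddCommGroup V] [InnerProductSpace ℝ V]

/-- In the Euclidean structure `x ↦ ‖A x‖` on `H`, the function `f` is one of revolution around
the line through `e`, and `⟪a, x⟫` is the coordinate of `x` along that line. -/
def AxisOn (f : V → ℝ) (H : Submodule ℝ V) (a e : V) : Prop :=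
  ∃ (m : ℕ) (A : V →ₗ[ℝ] EuclideanSpace ℝ (Fin m)), (∀ x ∈ H, A x = 0 → x = 0) ∧ e ∈ H ∧ e ≠ 0 ∧
    (∀ x ∈ H, ⟪a, x⟫ = ⟪A e, A x⟫) ∧
    ∀ x ∈ H, ∀ y ∈ H, ‖A x‖ = ‖A y‖ → ⟪a, x⟫ = ⟪a, y⟫ → f x = f y

theorem IsNormFunction.restrict {f : V → ℝ} (hf : IsNormFunction f) (W : Submodule ℝ V) :
    IsNormFunction fun x : W => f x where
  continuous := hf.continuous.comp continuous_subtype_val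
  map_smul c x := hf.map_smul c x
  pos x hx := hf.pos x fun h => hx (Subtype.ext h)
  add_le x y := hf.add_le x y

theorem AxisOn.parallelogramOn_of_axisOn [FiniteDimensional ℝ V] {f : V → ℝ}
    (hf : IsNormFunction f)
    {H H' W : Submodule ℝ V} {a e a' e' z : V} (h : AxisOn f H a e) (h' : AxisOn f H' a' e')
    (hW : W ≤ H) (hW' : W ≤ H') (hdim : 3 ≤ finrank ℝ W) (hz : z ∈ W) (haz : ⟪a, z⟫ = 0)
    (haz' : ⟪a', z⟫ ≠ 0) : ParallelogramOn f W := by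
  obtain ⟨m, A, hA, -, -, -, hfA⟩ := h
  obtain ⟨m', A', hA', -, -, -, hfA'⟩ := h'
  have key := parallelogram_of_two_revolutions (E := W) hdim (hf.restrict W)
    (A := A.comp W.subtype)
    ((injective_iff_map_eq_zero _).2 fun x hx => Subtype.ext (hA x (hW x.2) hx))
    ((innerₛₗ ℝ a).comp W.subtype)
    (fun x y hxy hl => hfA x (hW x.2) y (hW y.2) hxy hl)
    (A' := A'.comp W.subtype)
    ((injective_iff_map_eq_zero _).2 fun x hx => Subtype.ext (hA' x (hW' x.2) hx))
    ((innerₛₗ ℝ a').comp W.subtype)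
    (fun x y hxy hl => hfA' x (hW' x.2) y (hW' y.2) hxy hl)
    (z := ⟨z, hz⟩) haz haz'
  exact fun x hx y hy => key ⟨x, hx⟩ trivial ⟨y, hy⟩ trivial

theorem AxisOn.parallelogramOn {f : V → ℝ} (hf : IsNormFunction f) {H W : Submodule ℝ V}
    {a e : V} (h : AxisOn f H a e) (hW : W ≤ H) (ha : ∀ x ∈ W, ⟪a, x⟫ = 0) :
    ParallelogramOn f W := by
  obtain ⟨m, A, hA, -, -, -, hfA⟩ := h
  exact parallelogramOn_of_norm_map hf A (fun x hx => hA x (hW hx)) fun x hx y hy hxy =>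
    hfA x (hW hx) y (hW hy) hxy (by rw [ha x hx, ha y hy])

/-- If a section through the axis is Euclidean, then so is the whole norm of revolution. -/
theorem AxisOn.parallelogramOn_of_section {f : V → ℝ} (hf : IsNormFunction f)
    {H W : Submodule ℝ V} {a e y₀ : V} (h : AxisOn f H a e) (hW : W ≤ H) (he : e ∈ W)
    (hy₀ : y₀ ∈ W) (hne : y₀ ≠ 0) (hay₀ : ⟪a, y₀⟫ = 0) (hpar : ParallelogramOn f W) :
    ParallelogramOn f H := by
  obtain ⟨m, A, hA, heH, he0, ha, hfA⟩ := h
  have hAe : ‖A e‖ ≠ 0 := norm_ne_zero_iff.2 fun h => he0 (hA e heH h)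
  have hAy : ‖A y₀‖ ≠ 0 := norm_ne_zero_iff.2 fun h => hne (hA y₀ (hW hy₀) h)
  have hey : ⟪A e, A y₀⟫ = 0 := by rw [← ha y₀ (hW hy₀), hay₀]
  have hae : ⟪a, e⟫ = ‖A e‖ ^ 2 := by rw [ha e heH, real_inner_self_eq_norm_sq]
  have hnorm : ∀ s t : ℝ, ‖A (s • e + t • y₀)‖ ^ 2 = s ^ 2 * ‖A e‖ ^ 2 + t ^ 2 * ‖A y₀‖ ^ 2 := by
    intro s t
    rw [map_add, map_smul, map_smul, norm_add_sq_real, real_inner_smul_left,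
      real_inner_smul_right, hey, norm_smul, norm_smul, mul_pow, mul_pow, Real.norm_eq_abs,
      Real.norm_eq_abs, sq_abs, sq_abs]
    ring
  have hin : ∀ s t : ℝ, ⟪a, s • e + t • y₀⟫ = s * ‖A e‖ ^ 2 := by
    intro s t
    rw [inner_add_right, real_inner_smul_right, real_inner_smul_right, hay₀, hae]; ring
  have hmem : ∀ s t : ℝ, s • e + t • y₀ ∈ W := fun s t =>
    W.add_mem (W.smul_mem _ he) (W.smul_mem _ hy₀)
  -- Reflection in the axis, `t ↦ -t`, preserves `f`, so the parallelogram law removes the cross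
  -- term.
  have hplane : ∀ s t : ℝ, f (s • e + t • y₀) ^ 2 = s ^ 2 * f e ^ 2 + t ^ 2 * f y₀ ^ 2 := by
    intro s t
    have h1 : f (s • e + (-t) • y₀) = f (s • e + t • y₀) := by
      apply hfA _ (hW (hmem _ _)) _ (hW (hmem _ _))
      · rw [← sq_eq_sq₀ (norm_nonneg _) (norm_nonneg _), hnorm, hnorm]; ring
      · rw [hin, hin]
    have h2 := hpar (s • e) (W.smul_mem _ he) (t • y₀) (W.smul_mem _ hy₀)
    have h3 : s • e - t • y₀ = s • e + (-t) • y₀ := by rw [neg_smul, sub_eq_add_neg]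
    rw [h3, h1, hf.map_smul, hf.map_smul, mul_pow, mul_pow, sq_abs, sq_abs] at h2
    linarith
  have hform : ∀ x ∈ H, f x ^ 2 = (⟪a, x⟫ / ‖A e‖ ^ 2) ^ 2 * f e ^ 2 +
      (‖A x‖ ^ 2 - (⟪a, x⟫ / ‖A e‖ ^ 2) ^ 2 * ‖A e‖ ^ 2) / ‖A y₀‖ ^ 2 * f y₀ ^ 2 := by
    intro x hx
    obtain ⟨s, hs⟩ : ∃ s, s = ⟪a, x⟫ / ‖A e‖ ^ 2 := ⟨_, rfl⟩
    rw [← hs]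
    have hsa : ⟪a, x⟫ = s * ‖A e‖ ^ 2 := by rw [hs]; field_simp
    have hdef : ‖A (x - s • e)‖ ^ 2 = ‖A x‖ ^ 2 - s ^ 2 * ‖A e‖ ^ 2 := by
      rw [map_sub, map_smul, norm_sub_sq_real, real_inner_smul_right, real_inner_comm,
        ← ha x hx, hsa, norm_smul, mul_pow, Real.norm_eq_abs, sq_abs]
      ring
    -- `x` is rotated about the axis into the plane of `e` and `y₀`, which makes `f ^ 2` a quadratic
    -- form on all of `H`.
    have h1 : f x = f (s • e + (‖A (x - s • e)‖ / ‖A y₀‖) • y₀) := by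
      apply hfA x hx _ (hW (hmem _ _))
      · rw [← sq_eq_sq₀ (norm_nonneg _) (norm_nonneg _), hnorm, div_pow, hdef]
        field_simp
        ring
      · rw [hin, hsa]
    rw [h1, hplane, div_pow, hdef]
  intro x hx y hy
  rw [hform _ (H.add_mem hx hy), hform _ (H.sub_mem hx hy), hform x hx, hform y hy,
    inner_add_right, inner_sub_right, map_add, map_sub]
  have := parallelogram_law_with_norm ℝ (A x) (A y)
  linear_combination (f y₀ ^ 2 / ‖A y₀‖ ^ 2) * this

end Axis

/-! ### Codimension-two sections that are not Euclidean -/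

section Pairs

variable {V : Type*} [NormedAddCommGroup V] [InnerProductSpace ℝ V]

/-- The norm `f` is not Euclidean on the orthogonal complement of `ξ` and `η`. -/
def NonEuclideanPair (f : V → ℝ) (ξ η : V) : Prop :=
  ¬ ParallelogramOn f (Submodule.span ℝ {ξ, η})ᗮ

theorem mem_span_pair_orthogonal {ξ η x : V} :
    x ∈ (Submodule.span ℝ {ξ, η})ᗮ ↔ ⟪ξ, x⟫ = 0 ∧ ⟪η, x⟫ = 0 := by
  rw [Submodule.mem_orthogonal]
  constructor
  · intro h
    exact ⟨h _ (Submodule.subset_span (by simp)), h _ (Submodule.subset_span (by simp))⟩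
  · rintro ⟨h1, h2⟩ u hu
    obtain ⟨s, t, rfl⟩ := Submodule.mem_span_pair.1 hu
    rw [inner_add_left, real_inner_smul_left, real_inner_smul_left, h1, h2]; ring

theorem NonEuclideanPair.of_span_eq {f : V → ℝ} {ξ η ξ' η' : V} (h : NonEuclideanPair f ξ η)
    (hs : Submodule.span ℝ {ξ, η} = Submodule.span ℝ {ξ', η'}) : NonEuclideanPair f ξ' η' := by
  unfold NonEuclideanPair
  rw [← hs]; exact h

theorem NonEuclideanPair.symm {f : V → ℝ} {ξ η : V} (h : NonEuclideanPair f ξ η) :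
    NonEuclideanPair f η ξ :=
  h.of_span_eq (by rw [Set.pair_comm])

theorem NonEuclideanPair.add_smul {f : V → ℝ} {ξ η : V} (h : NonEuclideanPair f ξ η) {t : ℝ}
    (ht : t ≠ 0) : NonEuclideanPair f ξ (ξ + t • η) := by
  refine h.of_span_eq (le_antisymm ?_ ?_) <;> rw [Submodule.span_le, Set.pair_subset_iff]
  · refine ⟨Submodule.subset_span (by simp), Submodule.mem_span_pair.2 ⟨-t⁻¹, t⁻¹, ?_⟩⟩
    rw [_root_.smul_add, neg_smul, inv_smul_smul₀ ht]; abel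
  · exact ⟨Submodule.subset_span (by simp), Submodule.mem_span_pair.2 ⟨1, t, by simp⟩⟩

theorem gram_ne_zero {ξ η : V} (h : LinearIndependent ℝ ![ξ, η]) :
    ⟪ξ, ξ⟫ * ⟪η, η⟫ - ⟪ξ, η⟫ * ⟪ξ, η⟫ ≠ 0 := by
  intro hD
  rw [LinearIndependent.pair_iff] at h
  have hv : ⟪η, η⟫ • ξ + (-⟪ξ, η⟫) • η = 0 := by
    rw [← inner_self_eq_zero (𝕜 := ℝ)]
    simp only [inner_add_left, inner_add_right, real_inner_smul_left, real_inner_smul_right,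
      real_inner_comm ξ η]
    linear_combination ⟪η, η⟫ * hD
  have hη : η = 0 := inner_self_eq_zero.1 (h _ _ hv).1
  have := (h 0 1 (by rw [hη]; simp)).2
  exact one_ne_zero this

/-- The component of `x` orthogonal to `ξ` and `η`. -/
noncomputable def orthogonalComponent (x ξ η : V) : V :=
  x - (((⟪x, ξ⟫ * ⟪η, η⟫ - ⟪x, η⟫ * ⟪ξ, η⟫) / (⟪ξ, ξ⟫ * ⟪η, η⟫ - ⟪ξ, η⟫ * ⟪ξ, η⟫)) • ξ +
    ((⟪x, η⟫ * ⟪ξ, ξ⟫ - ⟪x, ξ⟫ * ⟪ξ, η⟫) / (⟪ξ, ξ⟫ * ⟪η, η⟫ - ⟪ξ, η⟫ * ⟪ξ, η⟫)) • η)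

theorem orthogonalComponent_mem {x ξ η : V}
    (hD : ⟪ξ, ξ⟫ * ⟪η, η⟫ - ⟪ξ, η⟫ * ⟪ξ, η⟫ ≠ 0) :
    orthogonalComponent x ξ η ∈ (Submodule.span ℝ {ξ, η})ᗮ := by
  rw [mem_span_pair_orthogonal]
  constructor
  · simp only [orthogonalComponent, inner_sub_right, inner_add_right, real_inner_smul_right]
    rw [real_inner_comm x ξ]
    linear_combination (-⟪x, ξ⟫) * mul_inv_cancel₀ hD
  · simp only [orthogonalComponent, inner_sub_right, inner_add_right, real_inner_smul_right]
    rw [real_inner_comm x η, real_inner_comm ξ η]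
    linear_combination (-⟪x, η⟫) * mul_inv_cancel₀ hD

theorem orthogonalComponent_of_mem {x ξ η : V} (hx : x ∈ (Submodule.span ℝ {ξ, η})ᗮ) :
    orthogonalComponent x ξ η = x := by
  rw [mem_span_pair_orthogonal, real_inner_comm, real_inner_comm x η] at hx
  simp [orthogonalComponent, hx.1, hx.2]

theorem continuousAt_orthogonalComponent (x : V) {ξ η : V}
    (hD : ⟪ξ, ξ⟫ * ⟪η, η⟫ - ⟪ξ, η⟫ * ⟪ξ, η⟫ ≠ 0) :
    ContinuousAt (fun p : V × V => orthogonalComponent x p.1 p.2) (ξ, η) := by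
  unfold orthogonalComponent
  have h : ∀ u v : V × V → ℝ, Continuous u → Continuous v → v (ξ, η) ≠ 0 →
      ContinuousAt (fun p => u p / v p) (ξ, η) := fun u v hu hv hne =>
    hu.continuousAt.div hv.continuousAt hne
  exact continuousAt_const.sub (((h _ _ (by fun_prop) (by fun_prop) hD).smul
    continuousAt_fst).add ((h _ _ (by fun_prop) (by fun_prop) hD).smul continuousAt_snd))

/-- Two vectors violating the parallelogram law are projected to the nearby codimension-two
subspaces. The projection is continuous where the Gram determinant is nonzero, so the violation
persists. -/
theorem NonEuclideanPair.eventually {f : V → ℝ} (hf : IsNormFunction f) {ξ η : V}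
    (h : NonEuclideanPair f ξ η) (hi : LinearIndependent ℝ ![ξ, η]) :
    ∀ᶠ p : V × V in nhds (ξ, η), NonEuclideanPair f p.1 p.2 := by
  have hD := gram_ne_zero hi
  unfold NonEuclideanPair ParallelogramOn at h
  push Not at h
  obtain ⟨x, hx, y, hy, hxy⟩ := h
  have hcx := continuousAt_orthogonalComponent x hD
  have hcy := continuousAt_orthogonalComponent y hD
  have hcf := hf.continuous
  have hc : ContinuousAt (fun p : V × V =>
      f (orthogonalComponent x p.1 p.2 + orthogonalComponent y p.1 p.2) ^ 2 +
      f (orthogonalComponent x p.1 p.2 - orthogonalComponent y p.1 p.2) ^ 2 -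
      (2 * f (orthogonalComponent x p.1 p.2) ^ 2 + 2 * f (orthogonalComponent y p.1 p.2) ^ 2))
      (ξ, η) := by
    fun_prop
  have hDc : ContinuousAt (fun p : V × V =>
      ⟪p.1, p.1⟫ * ⟪p.2, p.2⟫ - ⟪p.1, p.2⟫ * ⟪p.1, p.2⟫) (ξ, η) :=
    Continuous.continuousAt (by fun_prop)
  filter_upwards [hc.eventually_ne (y := 0) (by
      simp only [orthogonalComponent_of_mem hx, orthogonalComponent_of_mem hy]
      exact sub_ne_zero.2 hxy), hDc.eventually_ne (y := 0) hD] with p hp hpD hpar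
  exact hp (sub_eq_zero.2 (hpar _ (orthogonalComponent_mem hpD) _ (orthogonalComponent_mem hpD)))

theorem span_pair_orthogonal_le (ξ η : V) :
    (Submodule.span ℝ {ξ, η})ᗮ ≤ (Submodule.span ℝ {ξ})ᗮ :=
  Submodule.orthogonal_le (Submodule.span_mono (by simp))

/-- Otherwise the coordinate `a` vanishes on the section, where `f` would be proportional to a
Euclidean norm. -/
theorem NonEuclideanPair.coordinate_notMem {f : V → ℝ} (hf : IsNormFunction f) {ξ η a e : V}
    (h : AxisOn f (Submodule.span ℝ {ξ})ᗮ a e) (hne : NonEuclideanPair f ξ η) :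
    a ∉ Submodule.span ℝ {ξ, η} := fun ha =>
  hne (h.parallelogramOn hf (span_pair_orthogonal_le ξ η) fun _ hx =>
    (Submodule.mem_orthogonal _ _).1 hx a ha)

end Pairs

/-! ### Comparing the structures on two hyperplanes -/

section Hyperplanes

variable {V : Type*} [NormedAddCommGroup V] [InnerProductSpace ℝ V] [FiniteDimensional ℝ V]

theorem le_finrank_span_pair_orthogonal (ξ η : V) (hdim : 5 ≤ finrank ℝ V) :
    3 ≤ finrank ℝ (Submodule.span ℝ {ξ, η} : Submodule ℝ V)ᗮ := by
  classical
  have h1 := Submodule.finrank_add_finrank_orthogonal (Submodule.span ℝ {ξ, η})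
  rw [← Finset.coe_pair] at h1 ⊢
  have h2 := finrank_span_finset_le_card (R := ℝ) ({ξ, η} : Finset V)
  have h3 : ({ξ, η} : Finset V).card ≤ 2 := Finset.card_le_two
  rw [Set.finrank] at h2
  omega

/-- Otherwise some `z` in the common section is orthogonal to `a` but not to `a'`. The two
structures then have different parallels there and force `f` to be Euclidean; dimension 5 makes the
section at least 3-dimensional. -/
theorem NonEuclideanPair.coordinate_mem {f : V → ℝ} (hf : IsNormFunction f)
    (hdim : 5 ≤ finrank ℝ V) {ξ η a e a' e' : V} (h : AxisOn f (Submodule.span ℝ {ξ})ᗮ a e)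
    (h' : AxisOn f (Submodule.span ℝ {η})ᗮ a' e') (hne : NonEuclideanPair f ξ η) :
    a' ∈ Submodule.span ℝ {ξ, η, a} := by
  by_contra ha'
  rw [← Submodule.orthogonal_orthogonal (Submodule.span ℝ {ξ, η, a}),
    Submodule.mem_orthogonal] at ha'
  push Not at ha'
  obtain ⟨z, hz, hza'⟩ := ha'
  rw [Submodule.mem_orthogonal] at hz
  refine hne (h.parallelogramOn_of_axisOn hf h' (span_pair_orthogonal_le ξ η) ?_
    (le_finrank_span_pair_orthogonal ξ η hdim) (z := z) ?_
    (hz a (Submodule.subset_span (by simp))) (by rw [real_inner_comm]; exact hza'))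
  · rw [Set.pair_comm]; exact span_pair_orthogonal_le η ξ
  · exact mem_span_pair_orthogonal.2 ⟨hz ξ (Submodule.subset_span (by simp)),
      hz η (Submodule.subset_span (by simp))⟩

/-- Orthogonality to `e` puts the axis inside the section, and a Euclidean section through the axis
would make all of `ξᗮ` Euclidean. -/
theorem AxisOn.nonEuclideanPair {f : V → ℝ} (hf : IsNormFunction f) (hdim : 5 ≤ finrank ℝ V)
    {ξ η a e : V} (h : AxisOn f (Submodule.span ℝ {ξ})ᗮ a e)
    (hne : ¬ ParallelogramOn f (Submodule.span ℝ {ξ})ᗮ) (hη : ⟪e, η⟫ = 0) :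
    NonEuclideanPair f ξ η := by
  classical
  intro hpar
  obtain ⟨y, hy1, hy⟩ := exists_unit_inner_eq_zero ({ξ, η, a} : Finset V)
    (Finset.card_le_three.trans_lt (by omega))
  refine hne (h.parallelogramOn_of_section hf (span_pair_orthogonal_le ξ η) (y₀ := y) ?_ ?_ ?_
    (hy a (by simp)) hpar)
  · obtain ⟨m, A, -, he, -⟩ := h
    refine mem_span_pair_orthogonal.2 ⟨?_, by rw [real_inner_comm]; exact hη⟩
    exact (Submodule.mem_orthogonal _ _).1 he ξ (Submodule.mem_span_singleton_self ξ)
  · exact mem_span_pair_orthogonal.2 ⟨hy ξ (by simp), hy η (by simp)⟩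
  · rintro rfl
    simp at hy1

end Hyperplanes

/-! ### General position -/

section LinearAlgebra

theorem linearIndependent_vecCons {K V : Type*} [Field K] [AddCommGroup V] [Module K V] {n : ℕ}
    {v : Fin n → V} {x : V} (hv : LinearIndependent K v)
    (hx : x ∉ Submodule.span K (Set.range v)) : LinearIndependent K (Matrix.vecCons x v) :=
  linearIndependent_finCons.2 ⟨hv, hx⟩

theorem linearIndependent_four_iff {K V : Type*} [Field K] [AddCommGroup V] [Module K V]
    {x y z w : V} : LinearIndependent K ![x, y, z, w] ↔
      ∀ p q r s : K, p • x + q • y + r • z + s • w = 0 → p = 0 ∧ q = 0 ∧ r = 0 ∧ s = 0 := by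
  rw [Fintype.linearIndependent_iff]
  constructor
  · intro h p q r s hs
    have := h ![p, q, r, s] (by simpa [Fin.sum_univ_four] using hs)
    exact ⟨this 0, this 1, this 2, this 3⟩
  · intro h g hg
    have := h (g 0) (g 1) (g 2) (g 3) (by simpa [Fin.sum_univ_four] using hg)
    intro i
    fin_cases i
    exacts [this.1, this.2.1, this.2.2.1, this.2.2.2]

variable {V : Type*} [NormedAddCommGroup V] [InnerProductSpace ℝ V] [FiniteDimensional ℝ V]

/-- The hyperplane orthogonal to `e` is too large to fit in the span of `n` vectors; replacing `η`
by `-η` fixes the sign. -/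
theorem exists_inner_eq_zero_notMem_span (e d : V) {n : ℕ} (v : Fin n → V)
    (hn : n + 1 < finrank ℝ V) :
    ∃ η : V, ⟪e, η⟫ = 0 ∧ 0 ≤ ⟪η, d⟫ ∧ η ∉ Submodule.span ℝ (Set.range v) := by
  have hex : ∃ η : V, ⟪e, η⟫ = 0 ∧ η ∉ Submodule.span ℝ (Set.range v) := by
    by_contra! h
    have hle : (Submodule.span ℝ {e})ᗮ ≤ Submodule.span ℝ (Set.range v) := fun η hη =>
      h η ((Submodule.mem_orthogonal _ _).1 hη e (Submodule.mem_span_singleton_self e))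
    have h1 := Submodule.finrank_mono hle
    have h2 := finrank_range_le_card (R := ℝ) v
    have h3 := Submodule.finrank_add_finrank_orthogonal (Submodule.span ℝ {e})
    have h4 := finrank_span_le_card (R := ℝ) ({e} : Set V)
    rw [Set.finrank, Fintype.card_fin] at h2
    simp only [Set.toFinset_singleton, Finset.card_singleton] at h4
    omega
  obtain ⟨η, h1, h2⟩ := hex
  rcases le_total 0 ⟪η, d⟫ with h | h
  · exact ⟨η, h1, h, h2⟩
  · refine ⟨-η, by rw [inner_neg_right, h1, neg_zero], by rw [inner_neg_left]; linarith, ?_⟩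
    rwa [Submodule.neg_mem_iff]

end LinearAlgebra

/-! ### The planes span {ξ, a ξ} share a common vector -/

section Concurrency

variable {V : Type*} [NormedAddCommGroup V] [InnerProductSpace ℝ V] [FiniteDimensional ℝ V]
  {f : V → ℝ} {a e : V → V}

/-- `m` lies in both span {ζ, ξ₁, a ζ} and span {ζ, ξ₂, a ζ}; in general position these meet only in
span {ζ, a ζ}. -/
theorem mem_span_of_two_pairs (hf : IsNormFunction f) (hdim : 5 ≤ finrank ℝ V)
    (hax : ∀ ξ, ξ ≠ 0 → AxisOn f (Submodule.span ℝ {ξ})ᗮ (a ξ) (e ξ)) {m ξ₁ ξ₂ ζ : V}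
    (hli : LinearIndependent ℝ ![ξ₂, ξ₁, ζ, m]) (h₁ : NonEuclideanPair f ξ₁ ζ)
    (h₂ : NonEuclideanPair f ξ₂ ζ) (hm₁ : m ∈ Submodule.span ℝ {ξ₁, a ξ₁})
    (hm₂ : m ∈ Submodule.span ℝ {ξ₂, a ξ₂}) : m ∈ Submodule.span ℝ {ζ, a ζ} := by
  have hξ₂ : ξ₂ ≠ 0 := hli.ne_zero 0
  have hξ₁ : ξ₁ ≠ 0 := hli.ne_zero 1
  have hζ : ζ ≠ 0 := hli.ne_zero 2
  have hsub : ∀ ξ, ξ ≠ 0 → NonEuclideanPair f ξ ζ → m ∈ Submodule.span ℝ {ξ, a ξ} →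
      m ∈ Submodule.span ℝ {ζ, ξ, a ζ} := by
    intro ξ hξ hne hm
    have h := hne.symm.coordinate_mem hf hdim (hax ζ hζ) (hax ξ hξ)
    refine (Submodule.span_le.2 ?_) hm
    rw [Set.pair_subset_iff]
    exact ⟨Submodule.subset_span (by simp), h⟩
  obtain ⟨β, α, γ, h3⟩ := Submodule.mem_span_triple.1 (hsub ξ₁ hξ₁ h₁ hm₁)
  obtain ⟨β', α', γ', h4⟩ := Submodule.mem_span_triple.1 (hsub ξ₂ hξ₂ h₂ hm₂)
  rw [linearIndependent_four_iff] at hli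
  have hγ' : γ' ≠ 0 := by
    rintro rfl
    have := hli α' 0 β' (-1) (by rw [← h4]; module)
    norm_num at this
  -- Eliminating `a ζ` between the two expressions of `m` leaves a relation among independent
  -- vectors.
  have h5 := hli (-(γ * α')) (γ' * α) (γ' * β - γ * β') (γ - γ') (by
    linear_combination (norm := module) γ' • h3 - γ • h4)
  have hα : α = 0 := (mul_eq_zero.1 h5.2.1).resolve_left hγ'
  rw [Submodule.mem_span_pair]
  exact ⟨β, γ, by rw [← h3, hα]; module⟩

/-- With `ξ₁`, `ξ₂`, `m` fixed, the conditions on `ζ` in `mem_span_of_two_pairs` are open. -/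
theorem eventually_mem_span_of_two_pairs (hf : IsNormFunction f) (hdim : 5 ≤ finrank ℝ V)
    (hax : ∀ ξ, ξ ≠ 0 → AxisOn f (Submodule.span ℝ {ξ})ᗮ (a ξ) (e ξ)) {m ξ₁ ξ₂ ζ : V}
    (hli : LinearIndependent ℝ ![ξ₂, ξ₁, ζ, m]) (h₁ : NonEuclideanPair f ξ₁ ζ)
    (h₂ : NonEuclideanPair f ξ₂ ζ) (hm₁ : m ∈ Submodule.span ℝ {ξ₁, a ξ₁})
    (hm₂ : m ∈ Submodule.span ℝ {ξ₂, a ξ₂}) :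
    ζ ∈ interior {ζ : V | m ∈ Submodule.span ℝ {ζ, a ζ}} := by
  rw [mem_interior_iff_mem_nhds]
  have hli' := linearIndependent_four_iff.1 hli
  have hi₁ : LinearIndependent ℝ ![ξ₁, ζ] := LinearIndependent.pair_iff.2 fun s t hst => by
    have := hli' 0 s t 0 (by rw [← hst]; module)
    exact ⟨this.2.1, this.2.2.1⟩
  have hi₂ : LinearIndependent ℝ ![ξ₂, ζ] := LinearIndependent.pair_iff.2 fun s t hst => by
    have := hli' s 0 t 0 (by rw [← hst]; module)
    exact ⟨this.1, this.2.2.1⟩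
  have e₁ := (Continuous.prodMk_right ξ₁).continuousAt.eventually (h₁.eventually hf hi₁)
  have e₂ := (Continuous.prodMk_right ξ₂).continuousAt.eventually (h₂.eventually hf hi₂)
  have hc : Continuous fun z : V => ![ξ₂, ξ₁, z, m] := by
    refine continuous_pi fun i => ?_
    fin_cases i <;> simp <;> fun_prop
  filter_upwards [e₁, e₂, hc.continuousAt.eventually hli.eventually] with z hz₁ hz₂ hz
  exact mem_span_of_two_pairs hf hdim hax hz hz₁ hz₂ hm₁ hm₂

/-- Two points of the ball near `ξ` that form good pairs with `ξ` suffice. Directions orthogonal to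
`e ξ` give good pairs but may be tangent to the ball, so they are tilted inward by `ε • d`. Goodness
survives the tilt by openness, and survives moving from the direction to the point `ξ + t • (η + ε •
d)` because the span with `ξ` is unchanged. -/
theorem mem_interior_of_touching_ball (hf : IsNormFunction f) (hdim : 5 ≤ finrank ℝ V)
    (hax : ∀ ξ, ξ ≠ 0 → AxisOn f (Submodule.span ℝ {ξ})ᗮ (a ξ) (e ξ))
    (hne : ∀ ξ, ξ ≠ 0 → ¬ ParallelogramOn f (Submodule.span ℝ {ξ})ᗮ) {m ξ p : V}
    (hm : LinearIndependent ℝ ![ξ, m]) (hp : p ≠ ξ)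
    (hball : Metric.ball p (dist p ξ) ⊆ {ζ : V | m ∈ Submodule.span ℝ {ζ, a ζ}}) :
    ξ ∈ interior {ζ : V | m ∈ Submodule.span ℝ {ζ, a ζ}} := by
  have hξ : ξ ≠ 0 := hm.ne_zero 0
  set d := p - ξ with hd
  have hd0 : d ≠ 0 := sub_ne_zero.2 hp
  have hdd : 0 < ⟪d, d⟫ := real_inner_self_pos.2 hd0
  obtain ⟨η₁, he₁, hd₁, hs₁⟩ := exists_inner_eq_zero_notMem_span (e ξ) d ![ξ, m] (by omega)
  have hli3 := linearIndependent_vecCons hm hs₁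
  obtain ⟨η₂, he₂, hd₂, hs₂⟩ := exists_inner_eq_zero_notMem_span (e ξ) d ![η₁, ξ, m] (by omega)
  have hli4 := linearIndependent_vecCons hli3 hs₂
  have hli4' := linearIndependent_four_iff.1 hli4
  have hpert : ∀ η : V, ⟪e ξ, η⟫ = 0 → LinearIndependent ℝ ![ξ, η] →
      ∀ᶠ ε : ℝ in nhds 0, NonEuclideanPair f ξ (η + ε • d) := by
    intro η heη hi
    have h1 := ((hax ξ hξ).nonEuclideanPair hf hdim (hne ξ hξ) heη).eventually hf hi
    have hc : Continuous fun ε : ℝ => (ξ, η + ε • d) := by fun_prop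
    have h0 : (ξ, η) = (fun ε : ℝ => (ξ, η + ε • d)) 0 := by simp
    rw [h0] at h1
    exact hc.continuousAt.eventually h1
  have ev₁ := hpert η₁ he₁ (LinearIndependent.pair_iff.2 fun s t hst => by
    have := hli4' 0 t s 0 (by rw [← hst]; module)
    exact ⟨this.2.2.1, this.2.1⟩)
  have ev₂ := hpert η₂ he₂ (LinearIndependent.pair_iff.2 fun s t hst => by
    have := hli4' t 0 s 0 (by rw [← hst]; module)
    exact ⟨this.2.2.1, this.1⟩)
  have ev₃ : ∀ᶠ ε : ℝ in nhds 0, LinearIndependent ℝ ![η₂ + ε • d, η₁ + ε • d, ξ, m] := by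
    have hc : Continuous fun ε : ℝ => ![η₂ + ε • d, η₁ + ε • d, ξ, m] := by
      refine continuous_pi fun i => ?_
      fin_cases i <;> simp <;> fun_prop
    refine hc.continuousAt.eventually (LinearIndependent.eventually ?_)
    simpa using hli4
  obtain ⟨ε, ⟨⟨hε₁, hε₂⟩, hε₃⟩, hε⟩ :=
    (((ev₁.and ev₂).and ev₃).filter_mono nhdsWithin_le_nhds |>.and
      (self_mem_nhdsWithin (s := Set.Ioi (0 : ℝ)))).exists
  have hε0 : (0 : ℝ) < ε := hε
  have hstep : ∀ η : V, 0 ≤ ⟪η, d⟫ → ∀ᶠ t : ℝ in nhdsWithin 0 (Set.Ioi 0),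
      ξ + t • (η + ε • d) ∈ Metric.ball p (dist p ξ) := by
    intro η hη
    set θ := η + ε • d with hθ
    have hpos : 0 < ⟪θ, d⟫ := by
      rw [hθ, inner_add_left, real_inner_smul_left]
      have := mul_pos hε0 hdd
      linarith
    have hc : ContinuousAt (fun t : ℝ => t * ‖θ‖ ^ 2) 0 := Continuous.continuousAt (by fun_prop)
    have hlt : ∀ᶠ t : ℝ in nhds 0, t * ‖θ‖ ^ 2 < 2 * ⟪θ, d⟫ :=
      hc.eventually (gt_mem_nhds (by simpa using hpos))
    filter_upwards [hlt.filter_mono nhdsWithin_le_nhds, self_mem_nhdsWithin] with t ht ht0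
    have ht0' : (0 : ℝ) < t := ht0
    rw [Metric.mem_ball, dist_eq_norm, dist_eq_norm, ← hd]
    have h1 : ξ + t • θ - p = t • θ - d := by rw [hd]; abel
    rw [h1, ← sq_lt_sq₀ (norm_nonneg _) (norm_nonneg _), norm_sub_sq_real, real_inner_smul_left,
      norm_smul, mul_pow, Real.norm_eq_abs, sq_abs]
    nlinarith
  obtain ⟨t, ⟨ht₁, ht₂⟩, ht⟩ := (((hstep η₁ hd₁).and (hstep η₂ hd₂)).and
    (self_mem_nhdsWithin (s := Set.Ioi (0 : ℝ)))).exists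
  have ht0 : t ≠ 0 := ne_of_gt ht
  refine eventually_mem_span_of_two_pairs hf hdim hax (ξ₁ := ξ + t • (η₁ + ε • d))
    (ξ₂ := ξ + t • (η₂ + ε • d)) ?_ (hε₁.add_smul ht0).symm (hε₂.add_smul ht0).symm
    (hball ht₁) (hball ht₂)
  rw [linearIndependent_four_iff] at hε₃ ⊢
  intro p' q r s hsum
  have := hε₃ (p' * t) (q * t) (p' + q + r) s (by rw [← hsum]; module)
  have hp' := (mul_eq_zero.1 this.1).resolve_right ht0
  have hq := (mul_eq_zero.1 this.2.1).resolve_right ht0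
  refine ⟨hp', hq, ?_, this.2.2.2⟩
  have := this.2.2.1
  rw [hp', hq] at this
  simpa using this

theorem exists_concurrency_point (hf : IsNormFunction f) (hdim : 5 ≤ finrank ℝ V)
    (hax : ∀ ξ, ξ ≠ 0 → AxisOn f (Submodule.span ℝ {ξ})ᗮ (a ξ) (e ξ))
    (hne : ∀ ξ, ξ ≠ 0 → ¬ ParallelogramOn f (Submodule.span ℝ {ξ})ᗮ) :
    ∃ m : V, m ≠ 0 ∧ ∃ ζ ∉ Submodule.span ℝ {m},
      ζ ∈ interior {ζ : V | m ∈ Submodule.span ℝ {ζ, a ζ}} := by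
  have : Nontrivial V := Module.nontrivial_of_finrank_pos (R := ℝ) (by omega)
  obtain ⟨ξ₁, hξ₁⟩ := exists_ne (0 : V)
  obtain ⟨ξ₂, he₂, -, hs₂⟩ := exists_inner_eq_zero_notMem_span (e ξ₁) 0 ![ξ₁] (by omega)
  have hli2 := linearIndependent_vecCons (LinearIndependent.of_subsingleton (R := ℝ) (v := ![ξ₁])
    0 (by simpa using hξ₁)) hs₂
  have hξ₂ : ξ₂ ≠ 0 := hli2.ne_zero 0
  have hp12 := (hax ξ₁ hξ₁).nonEuclideanPair hf hdim (hne ξ₁ hξ₁) he₂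
  obtain ⟨α, β, γ, h⟩ := Submodule.mem_span_triple.1
    (hp12.coordinate_mem hf hdim (hax ξ₁ hξ₁) (hax ξ₂ hξ₂))
  have hnot := hp12.symm.coordinate_notMem hf (hax ξ₂ hξ₂)
  -- The two expressions of `a ξ₂` place this vector in both planes.
  set m := a ξ₂ - β • ξ₂ with hm
  have hm₁ : m ∈ Submodule.span ℝ {ξ₁, a ξ₁} :=
    Submodule.mem_span_pair.2 ⟨α, γ, by rw [hm, ← h]; module⟩
  have hm₂ : m ∈ Submodule.span ℝ {ξ₂, a ξ₂} :=
    Submodule.mem_span_pair.2 ⟨-β, 1, by rw [hm]; module⟩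
  have hms : m ∉ Submodule.span ℝ {ξ₂, ξ₁} := by
    intro hmem
    apply hnot
    have : a ξ₂ = m + β • ξ₂ := by rw [hm]; module
    rw [this]
    exact Submodule.add_mem _ hmem (Submodule.smul_mem _ _ (Submodule.subset_span (by simp)))
  have hli3 := linearIndependent_vecCons (x := m) hli2 (by
    simpa [Matrix.range_cons, Matrix.range_empty, Set.pair_comm ξ₁] using hms)
  obtain ⟨ζ', he', -, hs'⟩ :=
    exists_inner_eq_zero_notMem_span (e ξ₂) 0 ![m, ξ₂, ξ₁] (by omega)
  have hli4 := linearIndependent_four_iff.1 (linearIndependent_vecCons hli3 hs')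
  have hp := (hax ξ₂ hξ₂).nonEuclideanPair hf hdim (hne ξ₂ hξ₂) he'
  -- `ξ₂` itself is not independent of `ξ₁`, `ξ₂`, `m`, so it is pushed along `ζ'`. The pair with
  -- `ξ₁` stays good for small `t`, and the pair with `ξ₂` is good because `ζ'` is orthogonal to `e
  -- ξ₂`.
  have hev : ∀ᶠ t : ℝ in nhds 0, NonEuclideanPair f ξ₁ (ξ₂ + t • ζ') := by
    have h1 := hp12.eventually hf (LinearIndependent.pair_iff.2 fun s t hst => by
      have := hli4 0 0 t s (by rw [← hst]; module)
      exact ⟨this.2.2.2, this.2.2.1⟩)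
    have hc : Continuous fun t : ℝ => (ξ₁, ξ₂ + t • ζ') := by fun_prop
    have h0 : (ξ₁, ξ₂) = (fun t : ℝ => (ξ₁, ξ₂ + t • ζ')) 0 := by simp
    rw [h0] at h1
    exact hc.continuousAt.eventually h1
  obtain ⟨t, ht₁, ht⟩ := ((hev.filter_mono nhdsWithin_le_nhds).and
    (self_mem_nhdsWithin (s := Set.Ioi (0 : ℝ)))).exists
  have ht0 : t ≠ 0 := ne_of_gt ht
  have hli : LinearIndependent ℝ ![ξ₂, ξ₁, ξ₂ + t • ζ', m] := by
    rw [linearIndependent_four_iff]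
    intro p q r s hsum
    have := hli4 (r * t) s (p + r) q (by rw [← hsum]; module)
    have hr := (mul_eq_zero.1 this.1).resolve_right ht0
    have hpr := this.2.2.1
    rw [hr, add_zero] at hpr
    exact ⟨hpr, this.2.2.2, hr, this.2.1⟩
  refine ⟨m, hli.ne_zero 3, ξ₂ + t • ζ', fun hmem => ?_,
    eventually_mem_span_of_two_pairs hf hdim hax hli ht₁ (hp.add_smul ht0) hm₁ hm₂⟩
  obtain ⟨c, hc⟩ := Submodule.mem_span_singleton.1 hmem
  have := (linearIndependent_four_iff.1 hli) 0 0 1 (-c) (by rw [← hc]; module)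
  exact one_ne_zero this.2.2.1

/-- A norm on a space of dimension at least five, all of whose hyperplane sections are norms of
revolution, has a Euclidean hyperplane section. -/
theorem exists_parallelogramOn_hyperplane (hf : IsNormFunction f) (hdim : 5 ≤ finrank ℝ V)
    (hrev : ∀ ξ, ξ ≠ 0 → ∃ a e, AxisOn f (Submodule.span ℝ {ξ})ᗮ a e) :
    ∃ ξ : V, ξ ≠ 0 ∧ ParallelogramOn f (Submodule.span ℝ {ξ})ᗮ := by
  by_contra! hne
  choose! a e hax using hrev
  obtain ⟨m, hm, ζ, hζm, hζ⟩ := exists_concurrency_point hf hdim hax hne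
  set Ω := interior {ζ : V | m ∈ Submodule.span ℝ {ζ, a ζ}} with hΩ
  have hpair : ∀ ξ ∉ Submodule.span ℝ {m}, LinearIndependent ℝ ![ξ, m] := by
    intro ξ hξ
    refine linearIndependent_vecCons (LinearIndependent.of_subsingleton (R := ℝ) (v := ![m])
      0 (by simpa using hm)) (by simpa using hξ)
  have hall : ((Submodule.span ℝ {m} : Submodule ℝ V) : Set V)ᶜ ⊆ Ω := by
    have hconn : IsPreconnected ((Submodule.span ℝ {m} : Submodule ℝ V) : Set V)ᶜ := by
      refine (isConnected_compl_of_one_lt_codim ?_).isPreconnected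
      have h1 := Submodule.finrank_quotient_add_finrank (Submodule.span ℝ {m})
      rw [finrank_span_singleton hm] at h1
      rw [← Module.finrank_eq_rank]
      exact_mod_cast (by omega : 1 < finrank ℝ (V ⧸ Submodule.span ℝ {m}))
    refine hconn.subset_of_closure_inter_subset isOpen_interior ⟨ζ, hζm, hζ⟩ ?_
    rintro z ⟨hzc, hzm⟩
    by_contra hz
    have hopen : IsOpen ((Submodule.span ℝ {m} : Submodule ℝ V) : Set V)ᶜ :=
      (Submodule.closed_of_finiteDimensional _).isOpen_compl
    obtain ⟨δ, hδ, hball⟩ := Metric.isOpen_iff.1 hopen z hzm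
    -- The touching lemma is applied not at `z` but at a point `ξ` outside `Ω` nearest to `p ∈ Ω`.
    -- Taking `p` within `δ / 2` of `z` keeps `ξ` within `δ`, off the line through `m`.
    obtain ⟨p, hp, hzp⟩ := Metric.mem_closure_iff.1 hzc (δ / 2) (by positivity)
    obtain ⟨ξ, hξ, hdist⟩ := (isOpen_interior (s := {ζ : V | m ∈ Submodule.span ℝ {ζ, a ζ}})
      ).isClosed_compl.exists_infDist_eq_dist ⟨z, hz⟩ p
    have hpξ : dist p ξ ≤ dist p z := hdist ▸ Metric.infDist_le_dist_of_mem hz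
    have hξm : ξ ∉ Submodule.span ℝ {m} := by
      apply hball
      rw [Metric.mem_ball]
      have := dist_triangle ξ p z
      rw [dist_comm ξ p] at this
      rw [dist_comm z p] at hzp
      linarith
    refine hξ (mem_interior_of_touching_ball hf hdim hax hne (hpair ξ hξm) (p := p) ?_ ?_)
    · rintro rfl
      exact hξ hp
    · intro y hy
      by_contra hyC
      have hyΩ : y ∈ Ωᶜ := fun h => hyC (interior_subset h)
      have := Metric.infDist_le_dist_of_mem (x := p) hyΩ
      rw [hdist] at this
      rw [Metric.mem_ball, dist_comm] at hy
      linarith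
  refine hne m hm fun x hx y hy => ?_
  have hmx : ⟪m, x⟫ = 0 := (Submodule.mem_orthogonal _ _).1 hx m
    (Submodule.mem_span_singleton_self m)
  have hmy : ⟪m, y⟫ = 0 := (Submodule.mem_orthogonal _ _).1 hy m
    (Submodule.mem_span_singleton_self m)
  have hex : ∃ ξ : V, ⟪ξ, x⟫ = 0 ∧ ⟪ξ, y⟫ = 0 ∧ ξ ∉ Submodule.span ℝ {m} := by
    classical
    obtain ⟨ξ, h1, h⟩ := exists_unit_inner_eq_zero ({x, y, m} : Finset V)
      (Finset.card_le_three.trans_lt (by omega))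
    refine ⟨ξ, by rw [real_inner_comm]; exact h x (by simp),
      by rw [real_inner_comm]; exact h y (by simp), fun hmem => ?_⟩
    obtain ⟨c, hc⟩ := Submodule.mem_span_singleton.1 hmem
    have h2 := h m (by simp)
    rw [← hc, real_inner_smul_right, mul_eq_zero, inner_self_eq_zero] at h2
    rw [← hc, h2.resolve_right hm] at h1
    simp at h1
  obtain ⟨ξ, hξx, hξy, hξm⟩ := hex
  have hξ0 : ξ ≠ 0 := fun h => hξm (h ▸ Submodule.zero_mem _)
  have hmem : m ∈ Submodule.span ℝ {ξ, a ξ} :=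
    (interior_subset : Ω ⊆ {ζ : V | m ∈ Submodule.span ℝ {ζ, a ζ}}) (hall hξm)
  obtain ⟨s, t, hst⟩ := Submodule.mem_span_pair.1 hmem
  have ht : t ≠ 0 := by
    rintro rfl
    have := LinearIndependent.pair_iff.1 (hpair ξ hξm) s (-1) (by rw [← hst]; module)
    norm_num at this
  have haz : ∀ z, ⟪m, z⟫ = 0 → ⟪ξ, z⟫ = 0 → ⟪a ξ, z⟫ = 0 := by
    intro z hmz hξz
    rw [← hst, inner_add_left, real_inner_smul_left, real_inner_smul_left, hξz, mul_zero,
      zero_add, mul_eq_zero] at hmz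
    exact hmz.resolve_left ht
  exact (hax ξ hξ0).parallelogramOn hf (span_pair_orthogonal_le ξ (a ξ))
    (fun z hz => (mem_span_pair_orthogonal.1 hz).2) x
    (mem_span_pair_orthogonal.2 ⟨hξx, haz x hmx hξx⟩) y
    (mem_span_pair_orthogonal.2 ⟨hξy, haz y hmy hξy⟩)

end Concurrency

/-! ### Support functions of symmetric convex bodies -/

section SupportFunction

variable {V : Type*} [NormedAddCommGroup V] [InnerProductSpace ℝ V]

/-- The support function of a set. -/
noncomputable def supportFunction (S : Set V) (ξ : V) : ℝ :=
  sSup ((fun x => ⟪x, ξ⟫) '' S)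

theorem inner_le_supportFunction {S : Set V} (hS : IsCompact S) {x : V} (hx : x ∈ S) (ξ : V) :
    ⟪x, ξ⟫ ≤ supportFunction S ξ :=
  le_csSup (hS.image (f := fun x => ⟪x, ξ⟫) (by fun_prop)).bddAbove (Set.mem_image_of_mem _ hx)

theorem exists_inner_eq_supportFunction {S : Set V} (hS : IsCompact S) (hne : S.Nonempty)
    (ξ : V) : ∃ x ∈ S, supportFunction S ξ = ⟪x, ξ⟫ := by
  obtain ⟨x, hx, h⟩ := (hS.image (f := fun x => ⟪x, ξ⟫) (by fun_prop)).sSup_mem (hne.image _)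
  exact ⟨x, hx, h.symm⟩

theorem IsSymmetricConvexBody.zero_mem {S : Set V} (hS : IsSymmetricConvexBody S) :
    (0 : V) ∈ S := by
  obtain ⟨x, hx⟩ := hS.interior_nonempty
  have hx := interior_subset hx
  have := hS.convex hx (hS.neg_mem x hx) (a := 1 / 2) (b := 1 / 2) (by norm_num) (by norm_num)
    (by norm_num)
  simpa using this

theorem IsSymmetricConvexBody.isNormFunction {S : Set V} (hS : IsSymmetricConvexBody S) :
    IsNormFunction (supportFunction S) := by
  have hc := hS.isCompact
  have hatt := exists_inner_eq_supportFunction hc ⟨0, hS.zero_mem⟩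
  have hadd : ∀ ξ η, supportFunction S (ξ + η) ≤ supportFunction S ξ + supportFunction S η := by
    intro ξ η
    obtain ⟨x, hx, h⟩ := hatt (ξ + η)
    rw [h, inner_add_right]
    exact add_le_add (inner_le_supportFunction hc hx ξ) (inner_le_supportFunction hc hx η)
  have hle : ∀ (c : ℝ) ξ, supportFunction S (c • ξ) ≤ |c| * supportFunction S ξ := by
    intro c ξ
    obtain ⟨x, hx, h⟩ := hatt (c • ξ)
    rw [h, real_inner_smul_right]
    rcases le_total 0 c with h0 | h0
    · rw [abs_of_nonneg h0]
      exact mul_le_mul_of_nonneg_left (inner_le_supportFunction hc hx ξ) h0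
    · rw [abs_of_nonpos h0]
      have := mul_le_mul_of_nonneg_left (inner_le_supportFunction hc (hS.neg_mem x hx) ξ)
        (neg_nonneg.2 h0)
      rwa [inner_neg_left, neg_mul_neg] at this
  refine ⟨?_, fun c ξ => le_antisymm (hle c ξ) ?_, ?_, hadd⟩
  · obtain ⟨C, hC0, hC⟩ := hc.isBounded.exists_pos_norm_le
    have hbound : ∀ ξ, supportFunction S ξ ≤ C * ‖ξ‖ := by
      intro ξ
      obtain ⟨x, hx, h⟩ := hatt ξ
      rw [h]
      exact (real_inner_le_norm x ξ).trans (by gcongr; exact hC x hx)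
    refine (LipschitzWith.of_le_add_mul ⟨C, hC0.le⟩ fun ξ η => ?_).continuous
    have h1 := hadd η (ξ - η)
    rw [add_sub_cancel] at h1
    have h2 := hbound (ξ - η)
    rw [dist_eq_norm]
    exact h1.trans (add_le_add le_rfl h2)
  · by_cases hc0 : c = 0
    · obtain ⟨x, hx, h⟩ := hatt (c • ξ)
      simp only [hc0, zero_smul, abs_zero, zero_mul, inner_zero_right] at h ⊢
      exact h.ge
    · have h1 := hle c⁻¹ (c • ξ)
      rw [inv_smul_smul₀ hc0, abs_inv] at h1
      calc |c| * supportFunction S ξ ≤ |c| * (|c|⁻¹ * supportFunction S (c • ξ)) := by gcongr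
        _ = supportFunction S (c • ξ) := by
          have := abs_ne_zero.2 hc0
          field_simp
  · intro ξ hξ
    -- Both `x + t • ξ` and `-x` lie in `S`; adding the two support inequalities cancels `x` and
    -- bounds `t * ⟪ξ, ξ⟫` by twice the support function.
    obtain ⟨x, hx⟩ := hS.interior_nonempty
    have hev : ∀ᶠ t : ℝ in nhds 0, x + t • ξ ∈ S := by
      have hcont : Continuous fun t : ℝ => x + t • ξ := by fun_prop
      exact hcont.continuousAt.eventually (mem_interior_iff_mem_nhds.1 (by simpa using hx))
    obtain ⟨t, ht, ht0⟩ := ((hev.filter_mono nhdsWithin_le_nhds).and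
      (self_mem_nhdsWithin (s := Set.Ioi (0 : ℝ)))).exists
    have ht0' : (0 : ℝ) < t := ht0
    have h1 := inner_le_supportFunction hc ht ξ
    have h2 := inner_le_supportFunction hc (hS.neg_mem x (interior_subset hx)) ξ
    rw [inner_add_left, real_inner_smul_left] at h1
    rw [inner_neg_left] at h2
    have h3 : 0 < t * ⟪ξ, ξ⟫ := mul_pos ht0' (real_inner_self_pos.2 hξ)
    linarith

theorem mem_of_forall_inner_le_supportFunction [CompleteSpace V] {S : Set V}
    (hconv : Convex ℝ S) (hc : IsCompact S) (hne : S.Nonempty) {x : V}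
    (hx : ∀ ξ, ⟪x, ξ⟫ ≤ supportFunction S ξ) : x ∈ S := by
  by_contra hxS
  obtain ⟨l, u, hl, hu⟩ := geometric_hahn_banach_closed_point hconv hc.isClosed hxS
  set ξ := (InnerProductSpace.toDual ℝ V).symm l with hξ
  have hlξ : ∀ y, l y = ⟪y, ξ⟫ := by
    intro y
    rw [hξ, real_inner_comm, InnerProductSpace.toDual_symm_apply]
  obtain ⟨y, hy, h⟩ := exists_inner_eq_supportFunction hc hne ξ
  have h1 := hx ξ
  rw [h, ← hlξ, ← hlξ] at h1
  linarith [hl y hy]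

theorem supportFunction_proj [FiniteDimensional ℝ V] (H : Submodule ℝ V) (B : Set V) (ξ : H) :
    supportFunction (proj H B) ξ = supportFunction B (ξ : V) := by
  unfold supportFunction proj
  rw [Set.image_image]
  congr 1
  refine Set.image_congr fun x _ => ?_
  exact Submodule.inner_orthogonalProjectionOnto_eq_of_mem_right ξ x

end SupportFunction

/-! ### From bodies to norms and back -/

section Bodies

variable {X : Type*} [NormedAddCommGroup X] [InnerProductSpace ℝ X] [FiniteDimensional ℝ X]

/-- If the support function is `‖T ·‖`, then `S` is the unit ball of the dual norm `‖A ·‖`, with `A`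
contragredient to `T`. -/
theorem isEllipsoid_of_parallelogram {S : Set X} (hS : IsSymmetricConvexBody S)
    (hpar : ParallelogramOn (supportFunction S) ⊤) : IsEllipsoid S := by
  have hf := hS.isNormFunction
  obtain ⟨T, hT⟩ := exists_linearEquiv_of_parallelogram (supportFunction S) hf.map_smul hf.pos
    hf.add_le fun x y => hpar x trivial y trivial
  obtain ⟨A, hA⟩ := exists_contragredient T
  refine ⟨_, A.toAffineEquiv, ?_⟩
  have hmem : ∀ x, x ∈ S ↔ ‖A x‖ ≤ 1 := by
    intro x
    constructor
    · intro hx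
      obtain ⟨ξ, hξ⟩ := T.surjective (A x)
      have h1 := inner_le_supportFunction hS.isCompact hx ξ
      rw [← hA, ← hT, hξ, real_inner_self_eq_norm_mul_norm] at h1
      nlinarith [norm_nonneg (A x)]
    · intro hx
      refine mem_of_forall_inner_le_supportFunction hS.convex hS.isCompact ⟨0, hS.zero_mem⟩
        fun ξ => ?_
      rw [← hA, ← hT]
      have := real_inner_le_norm (A x) (T ξ)
      nlinarith [norm_nonneg (T ξ)]
  ext y
  rw [mem_closedBall_zero_iff]
  constructor
  · rintro ⟨x, hx, rfl⟩
    exact (hmem x).1 hx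
  · intro hy
    exact ⟨A.symm y, (hmem _).2 (by simpa using hy), by simp⟩

/-- A body of revolution that is symmetric about `o` is invariant under the rotations around
the parallel to its axis through `o`. -/
theorem IsAxisOfRevolution.add_mem_of_symmetric {m : ℕ} {K : Set (EuclideanSpace ℝ (Fin m))}
    {L : AffineSubspace ℝ (EuclideanSpace ℝ (Fin m))} (hL : IsAxisOfRevolution K L)
    {o u : EuclideanSpace ℝ (Fin m)} (hu : L.direction = Submodule.span ℝ {u}) (ho : o ∈ K)
    (hsymm : ∀ k, o + k ∈ K → o - k ∈ K) {k k' : EuclideanSpace ℝ (Fin m)} (hk : o + k ∈ K)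
    (hnorm : ‖k‖ = ‖k'‖) (hin : ⟪u, k⟫ = ⟪u, k'⟫) : o + k' ∈ K := by
  obtain ⟨-, -, hsec⟩ := hL
  have hperp : ∀ z, z ∈ L.directionᗮ ↔ ⟪u, z⟫ = 0 := fun z => by
    rw [hu, Submodule.mem_orthogonal_singleton_iff_inner_right]
  have hsec' : ∀ p, ∃ c ∈ L, ⟪u, c - p⟫ = 0 ∧ ∃ r : ℝ, ∀ x, ⟪u, x - p⟫ = 0 →
      (x ∈ K ↔ ‖x - c‖ ≤ r) := by
    intro p
    obtain ⟨c, hc, r, h⟩ := hsec (AffineSubspace.mk' p L.directionᗮ)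
      ⟨p, AffineSubspace.self_mem_mk' _ _⟩ (AffineSubspace.direction_mk' _ _)
    have hm : ∀ x, x ∈ AffineSubspace.mk' p L.directionᗮ ↔ ⟪u, x - p⟫ = 0 := fun x => by
      rw [AffineSubspace.mem_mk', vsub_eq_sub, hperp]
    refine ⟨c, hc.1, (hm c).1 hc.2, r, fun x hx => ?_⟩
    have := Set.ext_iff.1 h x
    simp only [Set.mem_inter_iff, SetLike.mem_coe, hm, hx, and_true, Metric.mem_closedBall,
      dist_eq_norm] at this
    exact this
  have hoL : o ∈ L := by
    obtain ⟨c, hcL, hco, r, hr⟩ := hsec' o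
    suffices c = o by rwa [← this]
    by_contra hne
    have hd : ‖c - o‖ ≠ 0 := norm_ne_zero_iff.2 (sub_ne_zero.2 hne)
    have hr0 : 0 ≤ r := (norm_nonneg _).trans ((hr o (by simp)).1 ho)
    -- `o + w` is the point of the ball around `c` farthest from `o`; its mirror image `o - w` lies
    -- at distance `r + 2 * ‖c - o‖` from `c`, outside the ball. So `c = o` and the axis passes
    -- through the centre of symmetry.
    set w := (1 + r / ‖c - o‖) • (c - o) with hw
    have hwu : ⟪u, w⟫ = 0 := by rw [hw, real_inner_smul_right, hco, mul_zero]
    have h1 : o + w ∈ K := by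
      rw [hr _ (by simpa using hwu)]
      have : o + w - c = (r / ‖c - o‖) • (c - o) := by rw [hw]; module
      rw [this, norm_smul, Real.norm_of_nonneg (by positivity)]
      field_simp
      exact le_rfl
    have h2 := (hr _ (by simpa using hwu)).1 (hsymm w h1)
    have : o - w - c = (-(2 + r / ‖c - o‖)) • (c - o) := by rw [hw]; module
    rw [this, norm_smul, norm_neg, Real.norm_of_nonneg (by positivity), add_mul,
      div_mul_cancel₀ _ hd] at h2
    have := (norm_nonneg (c - o)).lt_of_ne' hd
    linarith
  obtain ⟨c, hcL, hcp, r, hr⟩ := hsec' (o + k)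
  have hco : c - o ∈ Submodule.span ℝ {u} := by
    rw [← hu]; exact AffineSubspace.vsub_mem_direction hcL hoL
  obtain ⟨s, hs⟩ := Submodule.mem_span_singleton.1 hco
  have h1 := (hr (o + k) (by simp)).1 hk
  have e1 : o + k - c = k - s • u := by rw [hs]; abel
  have e2 : o + k' - c = k' - s • u := by rw [hs]; abel
  have hinn : ⟪u, o + k' - (o + k)⟫ = 0 := by
    rw [add_sub_add_left_eq_sub, inner_sub_right, hin, sub_self]
  rw [hr _ hinn, e2]
  rw [e1] at h1
  refine le_trans (le_of_eq ?_) h1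
  rw [← sq_eq_sq₀ (norm_nonneg _) (norm_nonneg _), norm_sub_sq_real, norm_sub_sq_real,
    real_inner_smul_right, real_inner_smul_right, real_inner_comm, ← hin, hnorm,
    real_inner_comm k u]

/-- After translation by `-g 0`, the image body is invariant under orthogonal maps fixing the axis
direction `u`. The reflection exchanging `A ξ` and `A η` is such a map, and it carries a support
point for `ξ` to a point of `S` whose product with `η` is the same. -/
theorem IsAffineBodyOfRevolution.supportFunction_eq {S : Set X} (hS : IsSymmetricConvexBody S)
    (hrev : IsAffineBodyOfRevolution S) :
    ∃ (m : ℕ) (A : X ≃ₗ[ℝ] EuclideanSpace ℝ (Fin m)) (u : EuclideanSpace ℝ (Fin m)), u ≠ 0 ∧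
      ∀ ξ η, ‖A ξ‖ = ‖A η‖ → ⟪u, A ξ⟫ = ⟪u, A η⟫ → supportFunction S ξ = supportFunction S η := by
  obtain ⟨-, m, K, ⟨-, L, hL⟩, g, hg⟩ := hrev
  obtain ⟨u, hu0, hu⟩ : ∃ u, u ≠ 0 ∧ L.direction = Submodule.span ℝ {u} := by
    obtain ⟨v, hv, hspan⟩ := finrank_eq_one_iff'.1 hL.2.1
    refine ⟨v, fun h => hv (Subtype.ext h), le_antisymm (fun w hw => ?_) ?_⟩
    · obtain ⟨c, hc⟩ := hspan ⟨w, hw⟩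
      exact Submodule.mem_span_singleton.2 ⟨c, congrArg Subtype.val hc⟩
    · rw [Submodule.span_singleton_le_iff_mem]
      exact v.2
  have hgx : ∀ x, g x = g 0 + g.linear x := fun x => by
    have := g.map_vadd 0 x
    simp only [vadd_eq_add, add_zero] at this
    rw [this, add_comm]
  have hK : ∀ k, g 0 + k ∈ K ↔ ∃ x ∈ S, g.linear x = k := by
    intro k
    rw [← hg]
    constructor
    · rintro ⟨x, hx, h⟩
      rw [hgx] at h
      exact ⟨x, hx, add_left_cancel h⟩
    · rintro ⟨x, hx, rfl⟩
      exact ⟨x, hx, hgx x⟩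
  have hrot : ∀ k k', g 0 + k ∈ K → ‖k‖ = ‖k'‖ → ⟪u, k⟫ = ⟪u, k'⟫ → g 0 + k' ∈ K := by
    intro k k' hk hn hi
    refine hL.add_mem_of_symmetric hu (hg ▸ Set.mem_image_of_mem g hS.zero_mem) (fun z hz => ?_)
      hk hn hi
    obtain ⟨x, hx, rfl⟩ := (hK z).1 hz
    rw [sub_eq_add_neg]
    exact (hK _).2 ⟨-x, hS.neg_mem x hx, map_neg _ _⟩
  obtain ⟨A, hA⟩ := exists_contragredient g.linear
  have hle : ∀ ξ η, ‖A ξ‖ = ‖A η‖ → ⟪u, A ξ⟫ = ⟪u, A η⟫ →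
      supportFunction S ξ ≤ supportFunction S η := by
    intro ξ η hn hi
    obtain ⟨x, hx, h⟩ := exists_inner_eq_supportFunction hS.isCompact ⟨0, hS.zero_mem⟩ ξ
    set ρ := Submodule.reflection (Submodule.span ℝ {A ξ - A η})ᗮ with hρ
    have hρξ : ρ (A ξ) = A η := Submodule.reflection_sub hn
    have hρu : ρ u = u := by
      rw [hρ, Submodule.reflection_eq_self_iff,
        Submodule.mem_orthogonal_singleton_iff_inner_left, inner_sub_right, hi, sub_self]
    obtain ⟨y, hy, hyx⟩ := (hK _).1 (hrot (g.linear x) (ρ (g.linear x)) ((hK _).2 ⟨x, hx, rfl⟩)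
      (ρ.norm_map _).symm (by
        have := ρ.inner_map_map u (g.linear x)
        rw [hρu] at this
        exact this.symm))
    rw [h, real_inner_comm, ← hA, ← ρ.inner_map_map, hρξ, ← hyx, hA, real_inner_comm]
    exact inner_le_supportFunction hS.isCompact hy η
  exact ⟨m, A, u, hu0, fun ξ η hn hi => le_antisymm (hle ξ η hn hi) (hle η ξ hn.symm hi.symm)⟩

theorem exists_axisOn_of_proj {B : Set X} {H : Submodule ℝ X}
    (hS : IsSymmetricConvexBody (proj H B)) (hrev : IsAffineBodyOfRevolution (proj H B)) :
    ∃ a e, AxisOn (supportFunction B) H a e := by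
  obtain ⟨m, A, u, hu, h⟩ := hrev.supportFunction_eq hS
  set A' : X →ₗ[ℝ] EuclideanSpace ℝ (Fin m) :=
    A.toLinearMap.comp H.orthogonalProjectionOnto.toLinearMap with hA'
  have hA'x : ∀ (x : X) (hx : x ∈ H), A' x = A ⟨x, hx⟩ := by
    intro x hx
    have := H.orthogonalProjectionOnto_mem_subspace_eq_self ⟨x, hx⟩
    simp only [hA', LinearMap.comp_apply]
    exact congrArg A this
  have hin : ∀ x, ⟪LinearMap.adjoint A' u, x⟫ = ⟪u, A' x⟫ := fun x =>
    LinearMap.adjoint_inner_left A' x u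
  have he : A' (A.symm u : H) = u := by
    rw [hA'x _ (A.symm u).2]; simp
  -- The axis vector is the preimage of `u`, and the adjoint turns the coordinate `⟪u, A' x⟫` into
  -- an inner product with a vector of the ambient space, so that different hyperplanes can be
  -- compared.
  refine ⟨LinearMap.adjoint A' u, (A.symm u : H), m, A', ?_, (A.symm u).2, ?_, ?_, ?_⟩
  · intro x hx h0
    rw [hA'x x hx] at h0
    simpa using h0
  · intro h0
    rw [h0, map_zero] at he
    exact hu he.symm
  · intro x _
    rw [hin, he]
  · intro x hx y hy hn hi
    rw [hin, hin, hA'x x hx, hA'x y hy] at hi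
    rw [hA'x x hx, hA'x y hy] at hn
    have := h _ _ hn hi
    rwa [supportFunction_proj, supportFunction_proj] at this

end Bodies

end AffineRevolution

theorem mainTheorem3 (n : ℕ) (hn : 4 ≤ n) (B : Set (EuclideanSpace ℝ (Fin (n + 1))))
    (hB : AffineRevolution.IsSymmetricConvexBody B)
    (hproj : ∀ H : Submodule ℝ (EuclideanSpace ℝ (Fin (n + 1))), Module.finrank ℝ H = n →
      AffineRevolution.IsSymmetricConvexBody (AffineRevolution.proj H B) ∧
        AffineRevolution.IsAffineBodyOfRevolution (AffineRevolution.proj H B)) :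
    ∃ H : Submodule ℝ (EuclideanSpace ℝ (Fin (n + 1))), Module.finrank ℝ H = n ∧
      AffineRevolution.IsEllipsoid (AffineRevolution.proj H B) := by
  have hfin : ∀ ξ : EuclideanSpace ℝ (Fin (n + 1)), ξ ≠ 0 →
      Module.finrank ℝ (Submodule.span ℝ {ξ})ᗮ = n := by
    intro ξ hξ
    have h := Submodule.finrank_add_finrank_orthogonal (Submodule.span ℝ {ξ})
    rw [finrank_span_singleton hξ, finrank_euclideanSpace_fin] at h
    omega
  obtain ⟨ξ, hξ, hpar⟩ := AffineRevolution.exists_parallelogramOn_hyperplane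
    hB.isNormFunction (by rw [finrank_euclideanSpace_fin]; omega) fun ξ hξ =>
      AffineRevolution.exists_axisOn_of_proj (hproj _ (hfin ξ hξ)).1 (hproj _ (hfin ξ hξ)).2
  refine ⟨_, hfin ξ hξ,
    AffineRevolution.isEllipsoid_of_parallelogram (hproj _ (hfin ξ hξ)).1 fun x _ y _ => ?_⟩
  simp only [AffineRevolution.supportFunction_proj]
  exact hpar x x.2 y y.2
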